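/- Let $\overline M$ be a compact smooth $n$-manifold with boundary, $M$ its interior and $\rho\ge 0$ a smooth boundary defining function. Let $\mathring g$ be an asymptotically Poincaré–Einstein metric on $M$ of class $C^{k,\alpha}$ ($k\ge 2$, $0\le\alpha<1$) and order $\delta$, where $\frac{n-1}{2}<\delta<n-1$ and $\delta\le k+\alpha$. That is, $\mathring g=\rho^{-2}b$ with a $C^{k,\alpha}$ Riemannian metric $b$ on $\overline M$ such that $|d\rho|_b^2=1$ on $\partial\overline M$, and $|\operatorname{Ric}_{\mathring g}+(n-1)\mathring g|_{\mathring g}\in C^{k-2,\alpha}_\delta(M)$. Here $C^{m,\alpha}_\delta(M)=\rho^{\delta}C^{m,\alpha}(M)$, and $C^{m,\alpha}(M)$ is the Hölder space of the complete asymptotically hyperbolic manifold $M$. Let $M=\bigcup_{r\to\infty}\Sigma_r$ be an exhaustion by compact domains with boundary such that the boundaries $\partial\Sigma_r$, $r\ge r_0$, foliate the end of $M$; that is, for $r\ge r_0$, $\Sigma_r=\{f\le r\}$ and $\partial\Sigma_r=\{f=r\}$ for a smooth function $f:M\to\mathbb R$ without critical points in $\{f\ge r_0\}$. For a Riemannian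 metric $g$ on $\Sigma_r$ of class $C^1$ up to the boundary let $H_g$ be the mean curvature of $\partial\Sigma_r$ with respect to the outward $g$-unit normal (the trace of $(V,W)\mapsto g(\nabla^g_V\nu_g,W)$ over $T\partial\Sigma_r$), let $dS_g$ be the Riemannian surface measure of $\partial\Sigma_r$, and let $$\mathfrak m_{ADM,\mathring g}(g,\partial\Sigma_r)=\int_{\partial\Sigma_r}\bigl(\mathring g^{ij}\mathring\nabla_i g_{jk}-\mathring\nabla_k(\mathring g^{ij}g_{ij})\bigr)\nu^k\,dS_{\mathring g},$$ where $\mathring\nabla$ is the Levi-Civita connection of $\mathring g$ and $\nu$ is the outward $\mathring g$-unit normal. (i) For every $r\ge r_0$ and every Riemannian metric $g$ on $\Sigma_r$, $C^1$ up to the boundary, such that $g=\mathring g$ at the points of $\partial\Sigma_r$ (as bilinear forms on $T_xM$, $x\in\partial\Sigma_r$), the integrands below are integrable and $$\mathfrak m_{ADM,\mathring g}(g,\partial\Sigma_r)=2\int_{\partial\Sigma_r}(H_{\mathring g}-H_g)\,dS_g .$$ (ii) In particular, for every family $g=g(r)$ which satisfies the assumptions of (i) for all sufficiently large $r$, $$\lim_{r\to\infty}\left(2\int_{\partial\Sigma_r}(H_{\mathring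 g}-H_{g(r)})\,dS_{g(r)}-\mathfrak m_{ADM,\mathring g}(g(r),\partial\Sigma_r)\right)=0 .$$ -/

import Mathlib

open Set Filter Topology MeasureTheory Manifold
open scoped NNReal ENNReal ContDiff

noncomputable section

namespace APE

/-! ### Riemannian calculus in coordinates

Here `D` is the subset of `ℝⁿ` on which a field is given, and all derivatives are taken within `D`.
For an open `D` these are the ordinary derivatives. At a boundary point of a domain with smooth
boundary they are the derivatives up to the boundary. -/

section Coordinates

variable {n : ℕ}

/-- The partial derivative `∂ᵢ f` at `y`, within `D`. -/
def pd (D : Set (EuclideanSpace ℝ (Fin n))) (i : Fin n) (f : EuclideanSpace ℝ (Fin n) → ℝ)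
    (y : EuclideanSpace ℝ (Fin n)) : ℝ :=
  fderivWithin ℝ f D y (EuclideanSpace.single i 1)

/-- The Christoffel symbol `Γᵏᵢⱼ` of the Levi-Civita connection of the metric `G`. -/
def christoffel (D : Set (EuclideanSpace ℝ (Fin n)))
    (G : EuclideanSpace ℝ (Fin n) → Matrix (Fin n) (Fin n) ℝ) (k i j : Fin n)
    (y : EuclideanSpace ℝ (Fin n)) : ℝ :=
  (1 / 2) * ∑ l, (G y)⁻¹ k l *
    (pd D i (fun z => G z j l) y + pd D j (fun z => G z i l) y - pd D l (fun z => G z i j) y)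

/-- The covariant derivative `∇ᵢ ηⱼ` of a covector field. -/
def covDerivForm (D : Set (EuclideanSpace ℝ (Fin n)))
    (G : EuclideanSpace ℝ (Fin n) → Matrix (Fin n) (Fin n) ℝ)
    (η : EuclideanSpace ℝ (Fin n) → Fin n → ℝ) (i j : Fin n)
    (y : EuclideanSpace ℝ (Fin n)) : ℝ :=
  pd D i (fun z => η z j) y - ∑ l, christoffel D G l i j y * η y l

/-- The covariant derivative `∇ᵢ Tⱼₖ` of a covariant 2-tensor field. -/
def covDerivTensor (D : Set (EuclideanSpace ℝ (Fin n)))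
    (G T : EuclideanSpace ℝ (Fin n) → Matrix (Fin n) (Fin n) ℝ) (i j k : Fin n)
    (y : EuclideanSpace ℝ (Fin n)) : ℝ :=
  pd D i (fun z => T z j k) y - ∑ l, christoffel D G l i j y * T y l k
    - ∑ l, christoffel D G l i k y * T y j l

/-- The Ricci tensor
`Rᵢⱼ = ∂ₖΓᵏᵢⱼ - ∂ⱼΓᵏᵢₖ + ΓᵏₖₗΓˡᵢⱼ - ΓᵏⱼₗΓˡᵢₖ`. -/
def ricci (D : Set (EuclideanSpace ℝ (Fin n)))
    (G : EuclideanSpace ℝ (Fin n) → Matrix (Fin n) (Fin n) ℝ) (i j : Fin n)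
    (y : EuclideanSpace ℝ (Fin n)) : ℝ :=
  ∑ k, pd D k (christoffel D G k i j) y - ∑ k, pd D j (christoffel D G k i k) y
    + ∑ k, ∑ l, christoffel D G k k l y * christoffel D G l i j y
    - ∑ k, ∑ l, christoffel D G k j l y * christoffel D G l i k y

/-- The squared norm `|dF|²` of a differential with respect to the metric `G`. -/
def gradNormSq (D : Set (EuclideanSpace ℝ (Fin n)))
    (G : EuclideanSpace ℝ (Fin n) → Matrix (Fin n) (Fin n) ℝ)
    (F : EuclideanSpace ℝ (Fin n) → ℝ) (y : EuclideanSpace ℝ (Fin n)) : ℝ :=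
  ∑ i, ∑ j, (G y)⁻¹ i j * pd D i F y * pd D j F y

/-- The unit conormal `νⱼ = ∂ⱼF / |dF|` of the level sets of `F`, in the direction of
increasing `F`. -/
def conormal (D : Set (EuclideanSpace ℝ (Fin n)))
    (G : EuclideanSpace ℝ (Fin n) → Matrix (Fin n) (Fin n) ℝ)
    (F : EuclideanSpace ℝ (Fin n) → ℝ) (y : EuclideanSpace ℝ (Fin n)) (j : Fin n) : ℝ :=
  pd D j F y / √(gradNormSq D G F y)

/-- The unit normal `νᵏ` of the level sets of `F`, in the direction of increasing `F`. -/
def normal (D : Set (EuclideanSpace ℝ (Fin n)))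
    (G : EuclideanSpace ℝ (Fin n) → Matrix (Fin n) (Fin n) ℝ)
    (F : EuclideanSpace ℝ (Fin n) → ℝ) (y : EuclideanSpace ℝ (Fin n)) (k : Fin n) : ℝ :=
  ∑ l, (G y)⁻¹ k l * conormal D G F y l

/-- The mean curvature of the level set of `F` with respect to the unit normal `ν`: the trace of
`(V, W) ↦ G(∇_V ν, W)` over the tangent space of the level set. -/
def meanCurv (D : Set (EuclideanSpace ℝ (Fin n)))
    (G : EuclideanSpace ℝ (Fin n) → Matrix (Fin n) (Fin n) ℝ)
    (F : EuclideanSpace ℝ (Fin n) → ℝ) (y : EuclideanSpace ℝ (Fin n)) : ℝ :=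
  ∑ i, ∑ j, ((G y)⁻¹ i j - normal D G F y i * normal D G F y j) *
    covDerivForm D G (conormal D G F) i j y

/-- The function `(G₀ⁱʲ ∇⁰ᵢ Gⱼₖ - ∇⁰ₖ (G₀ⁱʲ Gᵢⱼ)) νᵏ`, where `∇⁰` is the connection of `G₀` and
`ν` is the `G₀`-unit normal of the level set of `F`. -/
def massDensity (D : Set (EuclideanSpace ℝ (Fin n)))
    (G₀ G : EuclideanSpace ℝ (Fin n) → Matrix (Fin n) (Fin n) ℝ)
    (F : EuclideanSpace ℝ (Fin n) → ℝ) (y : EuclideanSpace ℝ (Fin n)) : ℝ :=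
  ∑ k, ((∑ i, ∑ j, (G₀ y)⁻¹ i j * covDerivTensor D G₀ G i j k y)
    - pd D k (fun z => ∑ i, ∑ j, (G₀ z)⁻¹ i j * G z i j) y) * normal D G₀ F y k

/-- The density of the Riemannian surface measure of the level set of `F` with respect to its
Euclidean surface measure: `√(det G · |n|²_G)`, where `n = ∂F / |∂F|` is the Euclidean unit
conormal. -/
def surfaceDensity (D : Set (EuclideanSpace ℝ (Fin n)))
    (G : EuclideanSpace ℝ (Fin n) → Matrix (Fin n) (Fin n) ℝ)
    (F : EuclideanSpace ℝ (Fin n) → ℝ) (y : EuclideanSpace ℝ (Fin n)) : ℝ :=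
  √((G y).det * (gradNormSq D G F y / ∑ i, pd D i F y ^ 2))

/-- `f` is of class `C^{k,α}` on `D`, locally uniformly. -/
def IsLocallyHolder (k : ℕ) (α : ℝ≥0) (D : Set (EuclideanSpace ℝ (Fin n)))
    (f : EuclideanSpace ℝ (Fin n) → ℝ) : Prop :=
  ContDiffOn ℝ k f D ∧
    ∀ y ∈ D, ∃ C : ℝ≥0, ∃ U ∈ 𝓝[D] y, HolderOnWith C α (iteratedFDerivWithin ℝ k f D) U

end Coordinates

/-! ### Tensor fields on a manifold with boundary -/

section Manifold

/-- Fields of bilinear forms on the tangent spaces of `X`. Fields on a subset of `X` are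
represented by fields on `X` whose values off the subset are never used. -/
abbrev TwoTensor (n : ℕ) [NeZero n] (X : Type*) [TopologicalSpace X]
    [ChartedSpace (EuclideanHalfSpace n) X] : Type _ :=
  (x : X) → TangentSpace (𝓡∂ n) x →L[ℝ] TangentSpace (𝓡∂ n) x →L[ℝ] ℝ

variable {n : ℕ} [NeZero n] {X : Type*} [TopologicalSpace X]
  [ChartedSpace (EuclideanHalfSpace n) X]

/-- The image of `S` in the chart at `p`. -/
def coordDom (S : Set X) (p : X) : Set (EuclideanSpace ℝ (Fin n)) :=
  (extChartAt (𝓡∂ n) p).target ∩ (extChartAt (𝓡∂ n) p).symm ⁻¹' S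

variable [IsManifold (𝓡∂ n) ∞ X]

/-- The coordinate vector field `∂ᵢ` of the chart at `p`, at the point with coordinates `y`. -/
def coordVec (p : X) (y : EuclideanSpace ℝ (Fin n)) (i : Fin n) :
    TangentSpace (𝓡∂ n) ((extChartAt (𝓡∂ n) p).symm y) :=
  tangentCoordChange (𝓡∂ n) p ((extChartAt (𝓡∂ n) p).symm y) ((extChartAt (𝓡∂ n) p).symm y)
    (EuclideanSpace.single i 1)

/-- The components `gᵢⱼ` of `g` in the chart at `p`. -/
def gram (g : TwoTensor n X) (p : X) (y : EuclideanSpace ℝ (Fin n)) :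
    Matrix (Fin n) (Fin n) ℝ :=
  Matrix.of fun i j => g ((extChartAt (𝓡∂ n) p).symm y) (coordVec p y i) (coordVec p y j)

/-- At every point of `S`, `g` is symmetric and positive definite. -/
def IsInnerOn (S : Set X) (g : TwoTensor n X) : Prop :=
  ∀ x ∈ S, (∀ v w, g x v w = g x w v) ∧ ∀ v, v ≠ 0 → 0 < g x v v

/-- `g` is a Riemannian metric of class `C¹` on `S`. For a domain `S` with boundary, this is `C¹`
regularity up to the boundary of `S`. -/
def IsMetricOn (S : Set X) (g : TwoTensor n X) : Prop :=
  IsInnerOn S g ∧ ∀ p i j, ContDiffOn ℝ 1 (fun y => gram g p y i j) (coordDom S p)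

/-! ### Asymptotically Poincaré–Einstein manifolds

`X` is the compact manifold with boundary, and the manifold `M` is its interior. -/

/-- A smooth boundary defining function. -/
structure IsBoundaryDefining (ρ : X → ℝ) : Prop where
  smooth : ContMDiff (𝓡∂ n) 𝓘(ℝ, ℝ) ∞ ρ
  nonneg : ∀ x, 0 ≤ ρ x
  zero_iff : ∀ x, ρ x = 0 ↔ x ∈ (𝓡∂ n).boundary X
  deriv_ne_zero : ∀ x ∈ (𝓡∂ n).boundary X, mfderiv (𝓡∂ n) 𝓘(ℝ, ℝ) ρ x ≠ 0

/-- `g` is an asymptotically hyperbolic metric of class `C^{k,α}` on the interior of `X`: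
`g = ρ⁻² b` with a `C^{k,α}` metric `b` on `X` such that `|dρ|²_b = 1` along the boundary. -/
def IsAH (k : ℕ) (α : ℝ≥0) (ρ : X → ℝ) (g : TwoTensor n X) : Prop :=
  IsBoundaryDefining (n := n) ρ ∧ ∃ b : TwoTensor n X,
    IsInnerOn univ b ∧
    (∀ p i j, IsLocallyHolder k α (extChartAt (𝓡∂ n) p).target (fun y => gram b p y i j)) ∧
    (∀ x ∈ (𝓡∂ n).interior X, g x = (ρ x ^ 2)⁻¹ • b x) ∧
    ∀ x ∈ (𝓡∂ n).boundary X,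
      gradNormSq (extChartAt (𝓡∂ n) x).target (gram b x)
        (ρ ∘ (extChartAt (𝓡∂ n) x).symm) (extChartAt (𝓡∂ n) x x) = 1

/-- The Hölder space `C^{m,α}(M)` of functions on the interior `M` of `X`, for asymptotically
hyperbolic metrics on `M`. The norm is the supremum of the Euclidean `C^{m,α}` norms in coordinates
`z ∈ B₁` which are obtained from charts of `X` through the rescaling `y = φ(q) + c ρ(q) z`. In these
coordinates the asymptotically hyperbolic metrics are uniformly equivalent to the Euclidean one,
with uniform bounds for the derivatives. -/
def IsHolder (m : ℕ) (α : ℝ≥0) (ρ : X → ℝ) (u : X → ℝ) : Prop :=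
  ∀ p : X, ∃ c : ℝ, 0 < c ∧ ∃ C : ℝ≥0, ∀ᶠ q in 𝓝 p, q ∈ (𝓡∂ n).interior X →
    Metric.ball (extChartAt (𝓡∂ n) p q) (c * ρ q) ⊆ coordDom ((𝓡∂ n).interior X) p ∧
    let f : EuclideanSpace ℝ (Fin n) → ℝ := fun z =>
      u ((extChartAt (𝓡∂ n) p).symm (extChartAt (𝓡∂ n) p q + (c * ρ q) • z))
    ContDiffOn ℝ m f (Metric.ball 0 1) ∧
      (∀ j ≤ m, ∀ z ∈ Metric.ball (0 : EuclideanSpace ℝ (Fin n)) 1,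
        ‖iteratedFDeriv ℝ j f z‖ ≤ C) ∧
      HolderOnWith C α (iteratedFDeriv ℝ m f) (Metric.ball 0 1)

/-- The weighted Hölder space `C^{m,α}_δ(M) = e^{-δ r} C^{m,α}(M)`, where `ρ = e^{-r}`. -/
def IsWeightedHolder (m : ℕ) (α : ℝ≥0) (δ : ℝ) (ρ : X → ℝ) (u : X → ℝ) : Prop :=
  IsHolder (n := n) m α ρ fun x => Real.exp (δ * (-Real.log (ρ x))) * u x

/-- The function `|Ric_g + (n - 1) g|_g`. -/
def einsteinDefect (g : TwoTensor n X) (x : X) : ℝ :=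
  let y := extChartAt (𝓡∂ n) x x
  let E : Fin n → Fin n → ℝ := fun i j =>
    ricci (coordDom ((𝓡∂ n).interior X) x) (gram g x) i j y + ((n : ℝ) - 1) * gram g x y i j
  √(∑ i, ∑ j, ∑ k, ∑ l, (gram g x y)⁻¹ i k * (gram g x y)⁻¹ j l * E i j * E k l)

/-- `g` is an asymptotically Poincaré–Einstein metric of class `C^{k,α}` and of order `δ` on the
interior of `X`, with boundary defining function `ρ`. -/
structure IsAPE (k : ℕ) (α : ℝ≥0) (δ : ℝ) (ρ : X → ℝ) (g : TwoTensor n X) : Prop where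
  two_le : 2 ≤ k
  alpha_lt : α < 1
  lt_delta : ((n : ℝ) - 1) / 2 < δ
  delta_lt : δ < (n : ℝ) - 1
  delta_le : δ ≤ k + α
  isAH : IsAH k α ρ g
  decay : IsWeightedHolder (n := n) (k - 2) α δ ρ (einsteinDefect g)

/-! ### Exhaustions -/

/-- An exhaustion of the interior `M` of `X` by compact domains `Σ_r` with boundary `∂Σ_r` which,
for `r ≥ start`, foliate the end: the parameter `r` is the value of a smooth function `level` on `M`
without critical points in `{level ≥ start}`, and `Σ_r = {level ≤ r}`, `∂Σ_r = {level = r}`. The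
values of `level` in the inner region `{level < start}` carry no information. -/
structure Exhaustion (n : ℕ) [NeZero n] (X : Type*) [TopologicalSpace X]
    [ChartedSpace (EuclideanHalfSpace n) X] where
  level : X → ℝ
  start : ℝ
  smooth : ContMDiffOn (𝓡∂ n) 𝓘(ℝ, ℝ) ∞ level ((𝓡∂ n).interior X)
  regular : ∀ x ∈ (𝓡∂ n).interior X, start ≤ level x → mfderiv (𝓡∂ n) 𝓘(ℝ, ℝ) level x ≠ 0
  isCompact : ∀ r, start ≤ r → IsCompact {x ∈ (𝓡∂ n).interior X | level x ≤ r}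

/-- The domain `Σ_r`. -/
def Exhaustion.dom {n : ℕ} [NeZero n] {X : Type*} [TopologicalSpace X]
    [ChartedSpace (EuclideanHalfSpace n) X] (e : Exhaustion n X) (r : ℝ) : Set X :=
  {x ∈ (𝓡∂ n).interior X | e.level x ≤ r}

/-- The boundary `∂Σ_r`. -/
def Exhaustion.bdry {n : ℕ} [NeZero n] {X : Type*} [TopologicalSpace X]
    [ChartedSpace (EuclideanHalfSpace n) X] (e : Exhaustion n X) (r : ℝ) : Set X :=
  {x ∈ (𝓡∂ n).interior X | e.level x = r}

/-- The mean curvature `H_g` of `∂Σ_r` in `(Σ_r, g)` at `x`, with respect to the outward unit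
normal. -/
def Exhaustion.H (e : Exhaustion n X) (r : ℝ) (g : TwoTensor n X) (x : X) : ℝ :=
  meanCurv (coordDom (e.dom r) x) (gram g x) (e.level ∘ (extChartAt (𝓡∂ n) x).symm)
    (extChartAt (𝓡∂ n) x x)

/-- The integrand of the mass integral of `g` relative to `g₀` over `∂Σ_r`. -/
def Exhaustion.massIntegrand (e : Exhaustion n X) (r : ℝ) (g₀ g : TwoTensor n X) (x : X) : ℝ :=
  massDensity (coordDom (e.dom r) x) (gram g₀ x) (gram g x)
    (e.level ∘ (extChartAt (𝓡∂ n) x).symm) (extChartAt (𝓡∂ n) x x)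

variable [T2Space X] [CompactSpace X] [MeasurableSpace X]

/-- A smooth partition of unity of `X` subordinate to the charts. -/
def chartPartition (n : ℕ) [NeZero n] (X : Type*) [TopologicalSpace X]
    [ChartedSpace (EuclideanHalfSpace n) X] [IsManifold (𝓡∂ n) ∞ X] [T2Space X] [CompactSpace X] :
    SmoothPartitionOfUnity X (𝓡∂ n) X univ :=
  (SmoothPartitionOfUnity.exists_isSubordinate_chartAt_source (𝓡∂ n) X).choose

/-- The part of the surface measure of `∂Σ_r` that lies in the chart at `p`. -/
def Exhaustion.chartSurfaceMeasure (e : Exhaustion n X) (r : ℝ) (g : TwoTensor n X) (p : X) :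
    Measure X :=
  ((μHE[n - 1].restrict (coordDom (e.bdry r) p)).withDensity fun y =>
    ENNReal.ofReal (surfaceDensity (coordDom (e.dom r) p) (gram g p)
      (e.level ∘ (extChartAt (𝓡∂ n) p).symm) y)).map (extChartAt (𝓡∂ n) p).symm

/-- The Riemannian surface measure `dS_g` of `∂Σ_r`, glued from charts by a partition of unity. -/
def Exhaustion.dS (e : Exhaustion n X) (r : ℝ) (g : TwoTensor n X) : Measure X :=
  Measure.sum fun p => (e.chartSurfaceMeasure r g p).withDensity fun x =>
    ENNReal.ofReal (chartPartition n X p x)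

/-- The mass integral of `g` relative to `g₀` over `∂Σ_r`. -/
def Exhaustion.massADM (e : Exhaustion n X) (r : ℝ) (g₀ g : TwoTensor n X) : ℝ :=
  ∫ x in e.bdry r, e.massIntegrand r g₀ g x ∂(e.dS r g₀)

end Manifold

end APE

end

noncomputable section

namespace APE

/-! The identity already holds pointwise on `∂Σ_r`, before integration. The tensor `g - g₀` vanishes
on `∂Σ_r = {F = r}`, and `F` is regular there. Hence in a chart its first derivatives, taken within
`Σ_r`, have the form `∂ₖ(g - g₀)ᵢⱼ = cᵢⱼ ∂ₖF` for some matrix `c` (`eq_smul_of_vanish_on_level`).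
Both the mass density and the mean curvature involve only the values of `g`, which agree with those
of `g₀` on `∂Σ_r`, and its first derivatives, so everything reduces to algebra in `g₀`, `c` and `w =
dF`.

In the mass density the divergence term contributes `|w| c(ν,ν)` and the trace term `-|w| tr c`. On
the other side the jump of the Christoffel symbols, projected to the tangent space of the level set,
gives `H₀ - H = -½ |w| (tr c - c(ν,ν))`. So the density and `2(H₀ - H)` both equal `jumpDensity`
(`AgreeOnLevel.massDensity_eq`, `AgreeOnLevel.two_mul_meanCurv_sub`). The two surface measures
coincide because their densities contain no derivative of the metric (`Exhaustion.dS_congr`).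

What remains is integrability. The integrand at `x` is computed in the chart at `x`, so its
continuity is not immediate; but `jumpDensity` is invariant under coordinate changes, which allows a
fixed chart to be used locally (`Exhaustion.massDensity_chart_change`). A continuous function on the
compact `∂Σ_r` is bounded, and `∂Σ_r` has finite surface measure because the implicit function
theorem covers it locally by Lipschitz images of balls. In (ii) the expression is zero for all large
`r`. -/

open Matrix in
/-- The common value of the mass density of `G₀ + c (F - r)` relative to `G₀` and of twice the jump
of the mean curvature on `{F = r}`, where `w = dF`. -/
def jumpDensity {n : ℕ} (G c : Matrix (Fin n) (Fin n) ℝ) (w : Fin n → ℝ) : ℝ :=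
  (G⁻¹ *ᵥ w ⬝ᵥ c *ᵥ (G⁻¹ *ᵥ w)) / √(w ⬝ᵥ G⁻¹ *ᵥ w) - √(w ⬝ᵥ G⁻¹ *ᵥ w) * (G⁻¹ * c).trace

-- All ingredients are contractions of tensors: the gradient `G⁻¹ w` transforms by `A⁻¹`, which
-- cancels against the factors `A` in `c`, and `G⁻¹ c` is merely conjugated by `A`.
open Matrix in
theorem jumpDensity_conj {n : ℕ} (G c A : Matrix (Fin n) (Fin n) ℝ) (w : Fin n → ℝ)
    (hA : IsUnit A.det) :
    jumpDensity (Aᵀ * G * A) (Aᵀ * c * A) (Aᵀ *ᵥ w) = jumpDensity G c w := by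
  have hAT : IsUnit (Aᵀ).det := by rwa [det_transpose]
  have hu : (Aᵀ * G * A)⁻¹ *ᵥ (Aᵀ *ᵥ w) = A⁻¹ *ᵥ (G⁻¹ *ᵥ w) := by
    rw [Matrix.mul_inv_rev, Matrix.mul_inv_rev, mulVec_mulVec, mulVec_mulVec]
    congr 1
    rw [Matrix.mul_assoc, Matrix.mul_assoc, nonsing_inv_mul _ hAT, Matrix.mul_one]
  have hAu : A *ᵥ (A⁻¹ *ᵥ (G⁻¹ *ᵥ w)) = G⁻¹ *ᵥ w := by
    rw [mulVec_mulVec, mul_nonsing_inv _ hA, one_mulVec]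
  have hdot : ∀ a b : Fin n → ℝ, Aᵀ *ᵥ a ⬝ᵥ b = a ⬝ᵥ A *ᵥ b := fun a b => by
    rw [mulVec_transpose, ← dotProduct_mulVec]
  have hN : (Aᵀ *ᵥ w) ⬝ᵥ ((Aᵀ * G * A)⁻¹ *ᵥ (Aᵀ *ᵥ w)) = w ⬝ᵥ G⁻¹ *ᵥ w := by
    rw [hu, hdot, hAu]
  have hq : ((Aᵀ * G * A)⁻¹ *ᵥ (Aᵀ *ᵥ w)) ⬝ᵥ (Aᵀ * c * A) *ᵥ ((Aᵀ * G * A)⁻¹ *ᵥ (Aᵀ *ᵥ w)) =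
      (G⁻¹ *ᵥ w) ⬝ᵥ c *ᵥ (G⁻¹ *ᵥ w) := by
    rw [hu, ← mulVec_mulVec, hAu, ← mulVec_mulVec, dotProduct_comm, hdot, hAu, dotProduct_comm]
  have ht : ((Aᵀ * G * A)⁻¹ * (Aᵀ * c * A)).trace = (G⁻¹ * c).trace := by
    have : (Aᵀ * G * A)⁻¹ * (Aᵀ * c * A) = A⁻¹ * (G⁻¹ * c) * A := by
      rw [Matrix.mul_inv_rev, Matrix.mul_inv_rev]
      calc A⁻¹ * (G⁻¹ * (Aᵀ)⁻¹) * (Aᵀ * c * A) = A⁻¹ * G⁻¹ * ((Aᵀ)⁻¹ * Aᵀ) * c * A := by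
            simp only [Matrix.mul_assoc]
        _ = _ := by rw [nonsing_inv_mul _ hAT, Matrix.mul_one]; simp only [Matrix.mul_assoc]
    rw [this, trace_mul_comm, ← Matrix.mul_assoc, mul_nonsing_inv _ hA, Matrix.one_mul]
  rw [jumpDensity, jumpDensity, hN, hq, ht]

/-! ### Pointwise comparison of mass density and mean curvature in coordinates. -/

section Pointwise

variable {n : ℕ} {D : Set (EuclideanSpace ℝ (Fin n))} {y : EuclideanSpace ℝ (Fin n)}
  {f f₁ f₂ : EuclideanSpace ℝ (Fin n) → ℝ}

theorem _root_.HasFDerivWithinAt.pd_eq {f' : EuclideanSpace ℝ (Fin n) →L[ℝ] ℝ}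
    (h : HasFDerivWithinAt f f' D y) (hD : UniqueDiffWithinAt ℝ D y) (i : Fin n) :
    pd D i f y = f' (EuclideanSpace.single i 1) := by
  rw [pd, h.fderivWithin hD]

theorem pd_congr (h : ∀ z ∈ D, f₁ z = f₂ z) (hy : y ∈ D) (i : Fin n) :
    pd D i f₁ y = pd D i f₂ y := by
  rw [pd, pd, fderivWithin_congr h (h y hy)]

theorem pd_const (a : ℝ) (i : Fin n) : pd D i (fun _ => a) y = 0 := by
  simp [pd]

theorem pd_sub (hD : UniqueDiffWithinAt ℝ D y) (h₁ : DifferentiableWithinAt ℝ f₁ D y)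
    (h₂ : DifferentiableWithinAt ℝ f₂ D y) (i : Fin n) :
    pd D i (fun z => f₁ z - f₂ z) y = pd D i f₁ y - pd D i f₂ y := by
  rw [(h₁.hasFDerivWithinAt.fun_sub h₂.hasFDerivWithinAt).pd_eq hD]; rfl

theorem pd_add (hD : UniqueDiffWithinAt ℝ D y) (h₁ : DifferentiableWithinAt ℝ f₁ D y)
    (h₂ : DifferentiableWithinAt ℝ f₂ D y) (i : Fin n) :
    pd D i (fun z => f₁ z + f₂ z) y = pd D i f₁ y + pd D i f₂ y := by
  rw [(h₁.hasFDerivWithinAt.fun_add h₂.hasFDerivWithinAt).pd_eq hD]; rfl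

theorem pd_mul (hD : UniqueDiffWithinAt ℝ D y) (h₁ : DifferentiableWithinAt ℝ f₁ D y)
    (h₂ : DifferentiableWithinAt ℝ f₂ D y) (i : Fin n) :
    pd D i (fun z => f₁ z * f₂ z) y = f₁ y * pd D i f₂ y + f₂ y * pd D i f₁ y := by
  rw [(h₁.hasFDerivWithinAt.fun_mul h₂.hasFDerivWithinAt).pd_eq hD]; rfl

theorem pd_sum {ι : Type*} (s : Finset ι) {f : ι → EuclideanSpace ℝ (Fin n) → ℝ}
    (hD : UniqueDiffWithinAt ℝ D y) (h : ∀ a ∈ s, DifferentiableWithinAt ℝ (f a) D y) (i : Fin n) :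
    pd D i (fun z => ∑ a ∈ s, f a z) y = ∑ a ∈ s, pd D i (f a) y := by
  rw [(HasFDerivWithinAt.fun_sum fun a ha => (h a ha).hasFDerivWithinAt).pd_eq hD]
  simp [pd]

/-- The inverse of a matrix field is as smooth as the field. -/
theorem contDiffWithinAt_matrix_inv {m : WithTop ℕ∞}
    {G : EuclideanSpace ℝ (Fin n) → Matrix (Fin n) (Fin n) ℝ}
    (hG : ∀ i j, ContDiffWithinAt ℝ m (fun z => G z i j) D y) (hdet : IsUnit (G y).det)
    (i j : Fin n) : ContDiffWithinAt ℝ m (fun z => (G z)⁻¹ i j) D y := by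
  have key : ∀ M : EuclideanSpace ℝ (Fin n) → Matrix (Fin n) (Fin n) ℝ,
      (∀ i j, ContDiffWithinAt ℝ m (fun z => M z i j) D y) →
      ContDiffWithinAt ℝ m (fun z => (M z).det) D y := by
    intro M hM
    simp only [Matrix.det_apply']
    exact ContDiffWithinAt.sum fun σ _ => contDiffWithinAt_const.mul
      (contDiffWithinAt_prod fun i _ => hM _ _)
  have hadj : ContDiffWithinAt ℝ m (fun z => (G z).adjugate i j) D y := by
    simp only [Matrix.adjugate_apply]
    refine key _ fun a b => ?_
    by_cases h : a = j
    · subst h; simpa using contDiffWithinAt_const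
    · simpa [Matrix.updateRow_apply, h] using hG a b
  have : (fun z => (G z)⁻¹ i j) = fun z => ((G z).det)⁻¹ * (G z).adjugate i j := by
    funext z
    simp [Matrix.inv_def, Ring.inverse_eq_inv']
  rw [this]
  exact ((key G hG).inv hdet.ne_zero).mul hadj

/-- A first-order perturbation `c (F - r)` of the metric leaves the metric itself unchanged on
`{F = r}` and changes its derivatives by `c ∂F`. -/
structure AgreeOnLevel (D : Set (EuclideanSpace ℝ (Fin n)))
    (G₀ G : EuclideanSpace ℝ (Fin n) → Matrix (Fin n) (Fin n) ℝ)
    (F : EuclideanSpace ℝ (Fin n) → ℝ) (c : Matrix (Fin n) (Fin n) ℝ)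
    (y : EuclideanSpace ℝ (Fin n)) : Prop where
  mem : y ∈ D
  uniqueDiff : UniqueDiffWithinAt ℝ D y
  contDiff₀ : ∀ i j, ContDiffWithinAt ℝ 1 (fun z => G₀ z i j) D y
  contDiff : ∀ i j, ContDiffWithinAt ℝ 1 (fun z => G z i j) D y
  isUnit_det : ∀ z ∈ D, IsUnit (G₀ z).det
  symm : ∀ z ∈ D, ∀ i j, G₀ z i j = G₀ z j i
  eq : G y = G₀ y
  diffF : ∀ j, DifferentiableWithinAt ℝ (pd D j F) D y
  pos : 0 < gradNormSq D G₀ F y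
  pd_sub : ∀ k i j, pd D k (fun z => G z i j) y - pd D k (fun z => G₀ z i j) y
    = c i j * pd D k F y

variable {G₀ G : EuclideanSpace ℝ (Fin n) → Matrix (Fin n) (Fin n) ℝ}
    {F : EuclideanSpace ℝ (Fin n) → ℝ} {c : Matrix (Fin n) (Fin n) ℝ}

theorem dotProduct_inv_mulVec_pd : (fun i => pd D i F y) ⬝ᵥ (G y)⁻¹.mulVec (fun i => pd D i F y) =
    gradNormSq D G F y := by
  simp only [dotProduct, Matrix.mulVec, gradNormSq, Finset.mul_sum]
  exact Finset.sum_congr rfl fun i _ => Finset.sum_congr rfl fun j _ => by ring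

theorem AgreeOnLevel.gradNormSq_eq (h : AgreeOnLevel D G₀ G F c y) :
    gradNormSq D G F y = gradNormSq D G₀ F y := by simp [gradNormSq, h.eq]

theorem AgreeOnLevel.conormal_eq (h : AgreeOnLevel D G₀ G F c y) :
    conormal D G F y = conormal D G₀ F y := by
  funext j; simp [conormal, h.gradNormSq_eq]

theorem AgreeOnLevel.normal_eq (h : AgreeOnLevel D G₀ G F c y) :
    normal D G F y = normal D G₀ F y := by
  funext j; simp [normal, h.conormal_eq, h.eq]

theorem AgreeOnLevel.inv_symm (h : AgreeOnLevel D G₀ G F c y) (i j : Fin n) :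
    (G₀ y)⁻¹ i j = (G₀ y)⁻¹ j i := by
  have : (G₀ y).transpose = G₀ y := by ext a b; exact h.symm y h.mem b a
  conv_lhs => rw [← this, ← Matrix.transpose_nonsing_inv]
  rfl

theorem AgreeOnLevel.sum_inv_mul (h : AgreeOnLevel D G₀ G F c y) :
    ∑ i, ∑ j, (G₀ y)⁻¹ i j * c i j = ((G₀ y)⁻¹ * c).trace := by
  rw [Matrix.trace, Finset.sum_comm]
  refine Finset.sum_congr rfl fun i _ => ?_
  rw [Matrix.diag_apply, Matrix.mul_apply]
  exact Finset.sum_congr rfl fun j _ => by rw [h.inv_symm]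

theorem AgreeOnLevel.pd_eq (h : AgreeOnLevel D G₀ G F c y) (k i j : Fin n) :
    pd D k (fun z => G z i j) y = pd D k (fun z => G₀ z i j) y + c i j * pd D k F y := by
  rw [← h.pd_sub]; ring

theorem AgreeOnLevel.christoffel_eq (h : AgreeOnLevel D G₀ G F c y) (k i j : Fin n) :
    christoffel D G k i j y = christoffel D G₀ k i j y + (1 / 2) * ∑ l, (G₀ y)⁻¹ k l *
      (c j l * pd D i F y + c i l * pd D j F y - c i j * pd D l F y) := by
  simp only [christoffel, h.pd_eq, h.eq, ← mul_add, ← Finset.sum_add_distrib]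
  congr 1
  exact Finset.sum_congr rfl fun l _ => by ring

/-- Metric compatibility of the Levi-Civita connection: lowering the index of the Christoffel
symbols leaves only first derivatives of the metric, which cancel by its symmetry. -/
theorem AgreeOnLevel.covDerivTensor_self (h : AgreeOnLevel D G₀ G F c y) (i j k : Fin n) :
    covDerivTensor D G₀ G₀ i j k y = 0 := by
  have hlow : ∀ i j k, ∑ l, christoffel D G₀ l i j y * G₀ y l k =
      (1 / 2) * (pd D i (fun z => G₀ z j k) y + pd D j (fun z => G₀ z i k) y
        - pd D k (fun z => G₀ z i j) y) := by
    intro i j k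
    simp only [christoffel, Finset.mul_sum, Finset.sum_mul]
    rw [Finset.sum_comm]
    have hinv : ∀ m, ∑ l, (G₀ y)⁻¹ l m * G₀ y l k = if m = k then 1 else 0 := by
      intro m
      have := congrFun (congrFun (Matrix.nonsing_inv_mul _ (h.isUnit_det y h.mem)) m) k
      rw [Matrix.mul_apply, Matrix.one_apply] at this
      rw [← this]
      exact Finset.sum_congr rfl fun l _ => by rw [h.inv_symm]
    rw [Finset.sum_eq_single k]
    · have := hinv k
      rw [if_pos rfl] at this
      rw [← mul_one (1 / 2 * _), ← this, Finset.mul_sum]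
      exact Finset.sum_congr rfl fun l _ => by ring
    · intro m _ hm
      have := hinv m
      rw [if_neg hm] at this
      rw [← mul_zero (1 / 2 * (pd D i (fun z => G₀ z j m) y + pd D j (fun z => G₀ z i m) y
        - pd D m (fun z => G₀ z i j) y)), ← this, Finset.mul_sum]
      exact Finset.sum_congr rfl fun l _ => by ring
    · simp
  have hs : ∀ i a b, pd D i (fun z => G₀ z a b) y = pd D i (fun z => G₀ z b a) y :=
    fun i a b => pd_congr (fun z hz => h.symm z hz a b) h.mem i
  have h2 : ∑ l, christoffel D G₀ l i k y * G₀ y j l = ∑ l, christoffel D G₀ l i k y * G₀ y l j :=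
    Finset.sum_congr rfl fun l _ => by rw [h.symm y h.mem]
  rw [covDerivTensor, h2, hlow, hlow, hs i k j, hs j i k]
  ring

/-- Since `G = G₀` at `y`, the connection terms are those of `∇⁰G₀ = 0`; only the jump of the
partial derivative survives. -/
theorem AgreeOnLevel.covDerivTensor_eq (h : AgreeOnLevel D G₀ G F c y) (i j k : Fin n) :
    covDerivTensor D G₀ G i j k y = c j k * pd D i F y := by
  have := h.covDerivTensor_self i j k
  rw [covDerivTensor] at this ⊢
  rw [h.pd_eq, h.eq]
  linarith

theorem gradNormSq_differentiableWithinAt (hG : ∀ i j, ContDiffWithinAt ℝ 1 (fun z => G z i j) D y)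
    (hdet : IsUnit (G y).det) (hF : ∀ j, DifferentiableWithinAt ℝ (pd D j F) D y) :
    DifferentiableWithinAt ℝ (gradNormSq D G F) D y := by
  unfold gradNormSq
  exact DifferentiableWithinAt.fun_sum fun i _ => DifferentiableWithinAt.fun_sum fun j _ =>
    (((contDiffWithinAt_matrix_inv hG hdet i j).differentiableWithinAt one_ne_zero).fun_mul
      (hF i)).fun_mul (hF j)

theorem invSqrt_gradNormSq_differentiableWithinAt
    (hG : ∀ i j, ContDiffWithinAt ℝ 1 (fun z => G z i j) D y)
    (hdet : IsUnit (G y).det) (hF : ∀ j, DifferentiableWithinAt ℝ (pd D j F) D y)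
    (hpos : 0 < gradNormSq D G F y) :
    DifferentiableWithinAt ℝ (fun z => (√(gradNormSq D G F z))⁻¹) D y :=
  ((gradNormSq_differentiableWithinAt hG hdet hF).sqrt hpos.ne').fun_inv (Real.sqrt_pos.2 hpos).ne'

theorem AgreeOnLevel.isUnit_det' (h : AgreeOnLevel D G₀ G F c y) : IsUnit (G y).det := by
  rw [h.eq]; exact h.isUnit_det y h.mem

/-- The derivatives of the two unit conormals differ by a multiple of the conormal. -/
theorem AgreeOnLevel.exists_pd_conormal_sub (h : AgreeOnLevel D G₀ G F c y) :
    ∃ a : Fin n → ℝ, ∀ i j, pd D i (fun z => conormal D G₀ F z j) y -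
      pd D i (fun z => conormal D G F z j) y = a i * conormal D G₀ F y j := by
  have h₀ := invSqrt_gradNormSq_differentiableWithinAt h.contDiff₀ (h.isUnit_det y h.mem) h.diffF
    h.pos
  have h₁ := invSqrt_gradNormSq_differentiableWithinAt h.contDiff h.isUnit_det' h.diffF
    (h.gradNormSq_eq ▸ h.pos)
  -- In the product rule for `∂ⱼF · |dF|⁻¹` the second derivatives of `F` have equal coefficients
  -- and cancel. The jump of `∂ᵢ|dF|⁻¹` multiplies `∂ⱼF`, and the factor `|dF|` turns `∂ⱼF` into the
  -- conormal.
  refine ⟨fun i => (pd D i (fun z => (√(gradNormSq D G₀ F z))⁻¹) y -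
    pd D i (fun z => (√(gradNormSq D G F z))⁻¹) y) * √(gradNormSq D G₀ F y), fun i j => ?_⟩
  simp only [conormal, div_eq_mul_inv]
  rw [pd_mul h.uniqueDiff (h.diffF j) h₀, pd_mul h.uniqueDiff (h.diffF j) h₁, h.gradNormSq_eq]
  have := (Real.sqrt_pos.2 h.pos).ne'
  field_simp
  ring

theorem AgreeOnLevel.massDensity_eq (h : AgreeOnLevel D G₀ G F c y) :
    massDensity D G₀ G F y = jumpDensity (G₀ y) c (fun i => pd D i F y) := by
  have htr : ∀ k, pd D k (fun z => ∑ i, ∑ j, (G₀ z)⁻¹ i j * G z i j) y =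
      (∑ i, ∑ j, (G₀ y)⁻¹ i j * c i j) * pd D k F y := by
    intro k
    have hi := fun i j => (contDiffWithinAt_matrix_inv h.contDiff₀ (h.isUnit_det y h.mem)
      i j).differentiableWithinAt one_ne_zero
    have hd := fun i j => ((h.contDiff i j).differentiableWithinAt one_ne_zero).fun_sub
      ((h.contDiff₀ i j).differentiableWithinAt one_ne_zero)
    -- Writing the trace as `n + tr(G₀⁻¹(G - G₀))` makes the derivative of `G₀⁻¹` drop out, because
    -- it multiplies `G - G₀`, which is zero at `y`.
    have hcong : pd D k (fun z => ∑ i, ∑ j, (G₀ z)⁻¹ i j * G z i j) y =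
        pd D k (fun z => (n : ℝ) + ∑ i, ∑ j, (G₀ z)⁻¹ i j * (G z i j - G₀ z i j)) y := by
      refine pd_congr (fun z hz => ?_) h.mem k
      have : (n : ℝ) = ∑ i, ∑ j, (G₀ z)⁻¹ i j * G₀ z i j := by
        have h1 := congrArg Matrix.trace (Matrix.nonsing_inv_mul _ (h.isUnit_det z hz))
        rw [Matrix.trace_one, Fintype.card_fin] at h1
        rw [← h1, Matrix.trace]
        refine Finset.sum_congr rfl fun i _ => ?_
        rw [Matrix.diag_apply, Matrix.mul_apply]
        exact Finset.sum_congr rfl fun j _ => by rw [h.symm z hz]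
      rw [this, ← Finset.sum_add_distrib]
      refine Finset.sum_congr rfl fun i _ => ?_
      rw [← Finset.sum_add_distrib]
      exact Finset.sum_congr rfl fun j _ => by ring
    rw [hcong, pd_add h.uniqueDiff (differentiableWithinAt_const _)
      (DifferentiableWithinAt.fun_sum fun i _ => DifferentiableWithinAt.fun_sum fun j _ =>
        (hi i j).fun_mul (hd i j)), pd_const, zero_add,
      pd_sum _ h.uniqueDiff fun i _ => DifferentiableWithinAt.fun_sum fun j _ =>
        (hi i j).fun_mul (hd i j), Finset.sum_mul]
    refine Finset.sum_congr rfl fun i _ => ?_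
    rw [pd_sum _ h.uniqueDiff fun j _ => (hi i j).fun_mul (hd i j), Finset.sum_mul]
    refine Finset.sum_congr rfl fun j _ => ?_
    rw [pd_mul h.uniqueDiff (hi i j) (hd i j), APE.pd_sub h.uniqueDiff
      ((h.contDiff i j).differentiableWithinAt one_ne_zero)
      ((h.contDiff₀ i j).differentiableWithinAt one_ne_zero), h.pd_sub, h.eq]
    ring
  have hs := (Real.sqrt_pos.2 h.pos)
  have hnu : ∀ k, normal D G₀ F y k =
      ((G₀ y)⁻¹.mulVec fun i => pd D i F y) k / √(gradNormSq D G₀ F y) := by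
    intro k
    simp only [normal, conormal, Matrix.mulVec, dotProduct, Finset.sum_div, mul_div_assoc]
  rw [jumpDensity, dotProduct_inv_mulVec_pd, massDensity]
  simp only [h.covDerivTensor_eq, htr, hnu, sub_mul, Finset.sum_sub_distrib]
  set N := gradNormSq D G₀ F y with hN
  set u := (G₀ y)⁻¹.mulVec fun i => pd D i F y with hu
  congr 1
  · rw [dotProduct_comm]
    have h5 : ∀ k, ∑ i, ∑ j, (G₀ y)⁻¹ i j * (c j k * pd D i F y) = ∑ j, c j k * u j := by
      intro k
      rw [Finset.sum_comm]
      refine Finset.sum_congr rfl fun j _ => ?_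
      rw [hu, Matrix.mulVec, dotProduct, Finset.mul_sum]
      exact Finset.sum_congr rfl fun i _ => by rw [h.inv_symm j i]; ring
    simp only [h5, dotProduct, Matrix.mulVec, Finset.sum_div, Finset.sum_mul]
    rw [Finset.sum_comm]
    exact Finset.sum_congr rfl fun j _ => Finset.sum_congr rfl fun k _ => by ring
  · have : ∀ k, (∑ i, ∑ j, (G₀ y)⁻¹ i j * c i j) * pd D k F y * (u k / √N) =
        (∑ i, ∑ j, (G₀ y)⁻¹ i j * c i j) / √N * (pd D k F y * u k) := fun k => by ring
    simp only [this, ← Finset.mul_sum]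
    have h3 : ∑ k, pd D k F y * u k = N := by
      rw [hN, ← dotProduct_inv_mulVec_pd]; rfl
    have h4 : ∑ i, ∑ j, (G₀ y)⁻¹ i j * c i j = ((G₀ y)⁻¹ * c).trace := by
      exact h.sum_inv_mul
    rw [h3, h4]
    field_simp
    rw [Real.sq_sqrt h.pos.le]

/-- In the jump of `∇ᵢηⱼ` every term but `-½|dF| cᵢⱼ` carries a factor `ηᵢ` or `ηⱼ`, and these are
killed by the tangential projector `G₀⁻¹ - ν⊗ν`. The unknown derivatives of the normalising factor
disappear in this way. -/
theorem AgreeOnLevel.two_mul_meanCurv_sub (h : AgreeOnLevel D G₀ G F c y) :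
    2 * (meanCurv D G₀ F y - meanCurv D G F y) =
      jumpDensity (G₀ y) c (fun i => pd D i F y) := by
  obtain ⟨a, ha⟩ := h.exists_pd_conormal_sub
  set N := gradNormSq D G₀ F y with hN
  have hs : 0 < √N := Real.sqrt_pos.2 h.pos
  have hss : √N * √N = N := Real.mul_self_sqrt h.pos.le
  set η : Fin n → ℝ := conormal D G₀ F y with hη
  set ν : Fin n → ℝ := normal D G₀ F y with hν
  have hw : ∀ i, pd D i F y = √N * η i := fun i => by
    rw [hη, conormal, mul_div_cancel₀ _ hs.ne']
  have hνm : ∀ m, ∑ l, (G₀ y)⁻¹ m l * η l = ν m := fun m => rfl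
  have hu : ∀ m, (G₀ y)⁻¹.mulVec (fun i => pd D i F y) m = √N * ν m := fun m => by
    simp only [Matrix.mulVec, dotProduct, hw, ← hνm, Finset.mul_sum]
    exact Finset.sum_congr rfl fun l _ => by ring
  have hην : ∑ m, η m * ν m = 1 := by
    have h1 : ∑ m, (√N * η m) * (√N * ν m) = N := by
      calc _ = (fun i => pd D i F y) ⬝ᵥ (G₀ y)⁻¹.mulVec (fun i => pd D i F y) :=
            Finset.sum_congr rfl fun m _ => by rw [hu, ← hw]
        _ = N := dotProduct_inv_mulVec_pd
    have h2 : ∑ m, (√N * η m) * (√N * ν m) = N * ∑ m, η m * ν m := by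
      rw [Finset.mul_sum]
      exact Finset.sum_congr rfl fun m _ => by
        calc _ = (√N * √N) * (η m * ν m) := by ring
          _ = _ := by rw [hss]
    exact mul_left_cancel₀ h.pos.ne' (by rw [← hN, ← h2, h1, mul_one])
  have hdiff : ∀ i j, covDerivForm D G₀ (conormal D G₀ F) i j y -
      covDerivForm D G (conormal D G F) i j y =
      (a i + √N / 2 * ∑ m, c i m * ν m) * η j + (√N / 2 * ∑ m, c j m * ν m) * η i
        - √N / 2 * c i j := by
    intro i j
    have hΓ : ∑ l, christoffel D G l i j y * η l = ∑ l, christoffel D G₀ l i j y * η l +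
        √N / 2 * ((∑ m, c j m * ν m) * η i + (∑ m, c i m * ν m) * η j - c i j) := by
      have h1 : ∑ l, (∑ m, (G₀ y)⁻¹ l m *
          (c j m * η i + c i m * η j - c i j * η m)) * η l =
          (∑ m, c j m * ν m) * η i + (∑ m, c i m * ν m) * η j - c i j := by
        simp only [Finset.sum_mul]
        rw [Finset.sum_comm]
        have h2 : ∀ m, ∑ l, (G₀ y)⁻¹ l m * (c j m * η i + c i m * η j - c i j * η m) * η l =
            c j m * ν m * η i + c i m * ν m * η j - c i j * (η m * ν m) := by
          intro m
          have : ∀ l, (G₀ y)⁻¹ l m * (c j m * η i + c i m * η j - c i j * η m) * η l =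
              (c j m * η i + c i m * η j - c i j * η m) * ((G₀ y)⁻¹ m l * η l) := fun l => by
            rw [h.inv_symm l m]; ring
          simp only [this, ← Finset.mul_sum, hνm]
          ring
        simp only [h2, Finset.sum_sub_distrib, Finset.sum_add_distrib, ← Finset.mul_sum, hην]
        ring
      rw [← h1, Finset.mul_sum, ← Finset.sum_add_distrib]
      refine Finset.sum_congr rfl fun l _ => ?_
      have h3 : ∑ m, (G₀ y)⁻¹ l m * (c j m * pd D i F y + c i m * pd D j F y - c i j * pd D m F y)
          = √N * ∑ m, (G₀ y)⁻¹ l m * (c j m * η i + c i m * η j - c i j * η m) := by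
        rw [Finset.mul_sum]
        exact Finset.sum_congr rfl fun m _ => by rw [hw, hw, hw]; ring
      rw [h.christoffel_eq, h3]
      ring
    have := ha i j
    rw [covDerivForm, covDerivForm, h.conormal_eq, ← hη, hΓ]
    linarith
  have hP : ∀ i, ∑ j, ((G₀ y)⁻¹ i j - ν i * ν j) * η j = 0 := fun i => by
    have : ∀ j, ((G₀ y)⁻¹ i j - ν i * ν j) * η j = (G₀ y)⁻¹ i j * η j - ν i * (η j * ν j) :=
      fun j => by ring
    simp only [this, Finset.sum_sub_distrib, ← Finset.mul_sum, hην, hνm]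
    ring
  have hP1 : ∀ X : Fin n → ℝ, ∑ i, ∑ j, ((G₀ y)⁻¹ i j - ν i * ν j) * (X i * η j) = 0 := fun X => by
    refine Finset.sum_eq_zero fun i _ => ?_
    rw [← mul_zero (X i), ← hP i, Finset.mul_sum]
    exact Finset.sum_congr rfl fun j _ => by ring
  have hP2 : ∀ X : Fin n → ℝ, ∑ i, ∑ j, ((G₀ y)⁻¹ i j - ν i * ν j) * (X j * η i) = 0 := fun X => by
    rw [Finset.sum_comm, ← hP1 X]
    exact Finset.sum_congr rfl fun i _ => Finset.sum_congr rfl fun j _ => by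
      rw [h.inv_symm]; ring
  have hH : meanCurv D G₀ F y - meanCurv D G F y =
      -(√N / 2) * ∑ i, ∑ j, ((G₀ y)⁻¹ i j - ν i * ν j) * c i j := by
    simp only [meanCurv, h.normal_eq, h.eq, ← hν]
    have h1 : ∀ i j, ((G₀ y)⁻¹ i j - ν i * ν j) * covDerivForm D G₀ (conormal D G₀ F) i j y -
        ((G₀ y)⁻¹ i j - ν i * ν j) * covDerivForm D G (conormal D G F) i j y =
        ((G₀ y)⁻¹ i j - ν i * ν j) * ((a i + √N / 2 * ∑ m, c i m * ν m) * η j) +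
        ((G₀ y)⁻¹ i j - ν i * ν j) * ((√N / 2 * ∑ m, c j m * ν m) * η i) +
        -(√N / 2) * (((G₀ y)⁻¹ i j - ν i * ν j) * c i j) := fun i j => by
      rw [← mul_sub, hdiff]; ring
    simp only [← Finset.sum_sub_distrib, h1, Finset.sum_add_distrib, hP1, hP2, ← Finset.mul_sum]
    rw [zero_add, zero_add]
  have hq : ((G₀ y)⁻¹.mulVec fun i => pd D i F y) ⬝ᵥ
      c.mulVec ((G₀ y)⁻¹.mulVec fun i => pd D i F y) = N * ∑ i, ∑ j, ν i * ν j * c i j := by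
    rw [funext hu]
    simp only [dotProduct, Matrix.mulVec, Finset.mul_sum]
    exact Finset.sum_congr rfl fun i _ => Finset.sum_congr rfl fun j _ => by
      calc _ = (√N * √N) * (ν i * ν j * c i j) := by ring
        _ = _ := by rw [hss]
  rw [hH, jumpDensity, hq, dotProduct_inv_mulVec_pd, ← hN, ← h.sum_inv_mul]
  simp only [sub_mul, Finset.sum_sub_distrib]
  have : N / √N = √N := by rw [div_eq_iff hs.ne', hss]
  rw [mul_div_right_comm, this]
  ring

end Pointwise

/-! ### Regular level sets: tangent cones, first-order vanishing and finite measure. -/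

section LevelSets

variable {E : Type*} [NormedAddCommGroup E] [NormedSpace ℝ E] {F h : E → ℝ} {F' h' : E →L[ℝ] ℝ}
  {D : Set E} {y : E}

theorem exists_apply_eq_one (hF' : F' ≠ 0) : ∃ v, F' v = 1 := by
  obtain ⟨v, hv⟩ : ∃ v, F' v ≠ 0 := by
    by_contra! H
    exact hF' (ContinuousLinearMap.ext H)
  exact ⟨(F' v)⁻¹ • v, by simp [hv]⟩

theorem range_eq_top_of_ne_zero (hF' : F' ≠ 0) : F'.range = ⊤ := by
  obtain ⟨v, hv⟩ := exists_apply_eq_one hF'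
  rw [eq_top_iff]
  rintro a -
  exact ⟨a • v, by simp [hv]⟩

/-- Sublevel sets of regular values have unique derivatives up to the boundary. -/
theorem uniqueDiffWithinAt_sublevel {U : Set E} {r : ℝ} (hU : U ∈ 𝓝 y) (hFr : F y ≤ r)
    (hF : HasFDerivAt F F' y) (hF' : F y = r → F' ≠ 0) :
    UniqueDiffWithinAt ℝ {z ∈ U | F z ≤ r} y := by
  rcases hFr.lt_or_eq with hlt | heq
  · refine uniqueDiffWithinAt_of_mem_nhds ?_
    filter_upwards [hU, hF.continuousAt.eventually_lt_const hlt] with z hz hz'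
    exact ⟨hz, hz'.le⟩
  obtain ⟨w, hw⟩ := exists_apply_eq_one (hF' heq)
  -- A ray from the boundary in a direction of strict decrease of `F` stays in the sublevel set for
  -- small positive time.
  have hcone : ∀ v, F' v < 0 → v ∈ tangentConeAt ℝ {z ∈ U | F z ≤ r} y := by
    intro v hv
    have hline : HasDerivAt (fun t : ℝ => F (y + t • v)) (F' v) 0 := by
      have h1 : HasDerivAt (fun t : ℝ => y + t • v) v 0 := by
        simpa using ((hasDerivAt_id (0 : ℝ)).smul_const v).const_add y
      have h2 : HasFDerivAt F F' (y + (0 : ℝ) • v) := by simpa using hF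
      exact h2.comp_hasDerivAt 0 h1
    have hneg : ∀ᶠ t in 𝓝[>] (0 : ℝ), F (y + t • v) < r := by
      have h3 := (hasDerivAt_iff_tendsto_slope.1 hline).mono_left
        (nhdsWithin_mono (0 : ℝ) fun t (ht : 0 < t) => ht.ne')
      filter_upwards [h3.eventually_lt_const hv, self_mem_nhdsWithin] with t ht (ht0 : 0 < t)
      rw [slope_def_field, sub_zero, zero_smul, add_zero, heq, div_lt_iff₀ ht0] at ht
      linarith
    have hin : ∀ᶠ t in 𝓝[>] (0 : ℝ), y + t • v ∈ U := by
      have : ContinuousAt (fun t : ℝ => y + t • v) 0 := by fun_prop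
      exact nhdsWithin_le_nhds (this.preimage_mem_nhds (by simpa using hU))
    refine mem_tangentConeAt_of_add_smul_mem (l := 𝓝[>] (0 : ℝ)) (c := id)
      (tendsto_id'.2 (nhdsWithin_mono _ fun t (ht : 0 < t) => ht.ne')) ?_
    filter_upwards [hneg, hin] with t h1 h2
    exact ⟨h2, h1.le⟩
  refine ⟨?_, subset_closure ⟨mem_of_mem_nhds hU, hFr⟩⟩
  have hspan : Submodule.span ℝ (tangentConeAt ℝ {z ∈ U | F z ≤ r} y) = ⊤ := by
    rw [eq_top_iff]
    rintro v -
    -- Every `v` is a difference of two directions of strict decrease: subtracting `|F' v| + 1`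
    -- times `w`, where `F' w = 1`, makes the derivative at most `-1`.
    have h1 : -((|F' v| + 1) • w) ∈ tangentConeAt ℝ {z ∈ U | F z ≤ r} y :=
      hcone _ (by have := abs_nonneg (F' v); simp [hw]; linarith)
    have h2 : v - (|F' v| + 1) • w ∈ tangentConeAt ℝ {z ∈ U | F z ≤ r} y :=
      hcone _ (by simp [hw]; linarith [le_abs_self (F' v)])
    have : v = (v - (|F' v| + 1) • w) - (-((|F' v| + 1) • w)) := by abel
    rw [this]
    exact Submodule.sub_mem _ (Submodule.subset_span h2) (Submodule.subset_span h1)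
  rw [hspan]
  exact dense_univ

variable [FiniteDimensional ℝ E]

/-- The derivative of a function that vanishes on a regular level set is a multiple of the
differential of the defining function. -/
theorem eq_smul_of_vanish_on_level (hF : HasStrictFDerivAt F F' y) (hF' : F' ≠ 0)
    (hh : HasFDerivWithinAt h h' D y) (hvan : ∀ᶠ z in 𝓝 y, F z = F y → z ∈ D ∧ h z = 0)
    {w : E} (hw : F' w = 1) : h' = h' w • F' := by
  have hr := range_eq_top_of_ne_zero hF'
  -- `γ` parametrises the level set through `y` by `ker F'`, with derivative at `0` the inclusion.
  -- As `h ∘ γ` vanishes near `0`, `h'` must vanish on `ker F'`.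
  set γ := hF.implicitFunction F F' hr (F y) with hγ
  have hγ0 : γ 0 = y := hF.implicitFunction_apply_image hr
  have hγ' : HasFDerivAt γ F'.ker.subtypeL 0 := (hF.to_implicitFunction hr).hasFDerivAt
  have hlev : ∀ᶠ u in 𝓝 (0 : F'.ker), F (γ u) = F y := by
    have : Tendsto (fun u : F'.ker => (F y, u)) (𝓝 0) (𝓝 (F y, 0)) :=
      tendsto_const_nhds.prodMk_nhds tendsto_id
    exact this.eventually (hF.map_implicitFunction_eq hr)
  have hgood : ∀ᶠ u in 𝓝 (0 : F'.ker), γ u ∈ D ∧ h (γ u) = 0 := by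
    have ht : Tendsto γ (𝓝 0) (𝓝 y) := by simpa [hγ0] using hγ'.continuousAt.tendsto
    filter_upwards [hlev, ht.eventually hvan] with u h1 h2 using h2 h1
  have hcomp : HasFDerivWithinAt (h ∘ γ) (h' ∘L F'.ker.subtypeL) (γ ⁻¹' D) 0 :=
    HasFDerivWithinAt.comp (t := D) 0 (by rwa [hγ0]) hγ'.hasFDerivWithinAt (mapsTo_preimage _ _)
  -- `D` contains the level set near `y`, so `γ ⁻¹' D` is a neighbourhood of `0` and the derivative
  -- within it is a full derivative.
  have hcomp' := hcomp.hasFDerivAt (hgood.mono fun u hu => hu.1)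
  have hzero : HasFDerivAt (h ∘ γ) (0 : F'.ker →L[ℝ] ℝ) 0 :=
    (hasFDerivAt_const (0 : ℝ) (0 : F'.ker)).congr_of_eventuallyEq (hgood.mono fun u hu => hu.2)
  have hker := hcomp'.unique hzero
  ext v
  have hv : v - F' v • w ∈ F'.ker := by simp [hw]
  have := congrArg (fun L : F'.ker →L[ℝ] ℝ => L ⟨_, hv⟩) hker
  simp only [ContinuousLinearMap.comp_apply, Submodule.subtypeL_apply, map_sub, map_smul,
    _root_.zero_apply, smul_eq_mul] at this
  simp only [_root_.smul_apply, smul_eq_mul]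
  linarith

variable [MeasurableSpace E] [BorelSpace E]

/-- Compact pieces of regular level sets have finite hypersurface measure. -/
theorem euclideanHausdorffMeasure_lt_top_of_level {K : Set E} {r : ℝ} (hK : IsCompact K)
    (hF : ∀ y ∈ K, F y = r ∧ ∃ F' : E →L[ℝ] ℝ, F' ≠ 0 ∧ HasStrictFDerivAt F F' y) :
    μHE[Module.finrank ℝ E - 1] K < ⊤ := by
  refine hK.measure_lt_top_of_nhdsWithin fun y hy => ?_
  obtain ⟨hFy, F', hF', hst⟩ := hF y hy
  have hr := range_eq_top_of_ne_zero hF'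
  have hrank : Module.finrank ℝ F'.ker = Module.finrank ℝ E - 1 := by
    have h1 := LinearMap.finrank_range_add_finrank_ker (F' : E →ₗ[ℝ] ℝ)
    have h2 : Module.finrank ℝ (F' : E →ₗ[ℝ] ℝ).range = 1 := by
      have : (F' : E →ₗ[ℝ] ℝ).range = ⊤ := hr
      rw [this, finrank_top, Module.finrank_self]
    have h3 : Module.finrank ℝ F'.ker = Module.finrank ℝ (F' : E →ₗ[ℝ] ℝ).ker := rfl
    omega
  obtain ⟨C, s, hs, hLip⟩ := (hst.to_implicitFunction hr).exists_lipschitzOnWith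
  obtain ⟨ε, hε, hball⟩ := Metric.nhds_basis_closedBall.mem_iff.1 hs
  set Φ := hst.implicitToOpenPartialHomeomorph F F' hr with hΦ
  have hcont : ContinuousAt (fun x => (Φ x).2) y :=
    continuous_snd.continuousAt.comp
      (Φ.continuousAt (hst.mem_implicitToOpenPartialHomeomorph_source hr))
  have hΦy : (Φ y).2 = 0 := by rw [hΦ, hst.implicitToOpenPartialHomeomorph_self]
  have hnear : ∀ᶠ x in 𝓝 y, (Φ x).2 ∈ Metric.closedBall (0 : F'.ker) ε :=
    hcont.preimage_mem_nhds (by rw [hΦy]; exact Metric.closedBall_mem_nhds _ hε)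
  -- Near `y` the set lies in a Lipschitz image of a ball in `ker F'`, a space of the same dimension
  -- as the Hausdorff measure, so the ball has finite measure.
  refine ⟨hst.implicitFunction F F' hr (F y) '' Metric.closedBall 0 ε, ?_, ?_⟩
  · filter_upwards [nhdsWithin_le_nhds (hst.eq_implicitFunction hr), nhdsWithin_le_nhds hnear,
      self_mem_nhdsWithin] with x h1 h2 h3
    refine ⟨_, h2, ?_⟩
    rw [hFy, ← (hF x h3).1]
    exact h1
  · rw [Measure.euclideanHausdorffMeasure_def, ENNReal.smul_def, Measure.smul_apply, smul_eq_mul,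
      ← hrank]
    refine ENNReal.mul_lt_top ENNReal.coe_lt_top ?_
    refine ((hLip.mono hball).hausdorffMeasure_image_le (Nat.cast_nonneg _)).trans_lt ?_
    exact ENNReal.mul_lt_top (ENNReal.rpow_lt_top_of_nonneg (Nat.cast_nonneg _) ENNReal.coe_ne_top)
      (isCompact_closedBall _ _).measure_lt_top

end LevelSets

/-- The product rule at a zero of a differentiable factor, where the other factor is only
continuous. -/
theorem hasFDerivWithinAt_mul_of_eq_zero {E : Type*} [NormedAddCommGroup E] [NormedSpace ℝ E]
    {a b : E → ℝ} {b' : E →L[ℝ] ℝ} {D : Set E} {y : E} (ha : ContinuousWithinAt a D y)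
    (hb : HasFDerivWithinAt b b' D y) (hby : b y = 0) :
    HasFDerivWithinAt (fun z => a z * b z) (a y • b') D y := by
  have hO : b =O[𝓝[D] y] fun z => z - y := by
    simpa [hby] using hb.isBigO_sub
  have ho : (fun z => a z - a y) =o[𝓝[D] y] fun _ => (1 : ℝ) := by
    rw [Asymptotics.isLittleO_one_iff]
    simpa using Tendsto.sub (ha : Tendsto a _ _) (tendsto_const_nhds (x := a y))
  have h1 : (fun z => (a z - a y) * b z) =o[𝓝[D] y] fun z => z - y := by
    have := ho.mul_isBigO hO.norm_right
    simpa using this.norm_right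
  have h2 : (fun z => a y * (b z - b y - b' (z - y))) =o[𝓝[D] y] fun z => z - y :=
    hb.isLittleO.const_mul_left _
  refine HasFDerivWithinAt.of_isLittleO ((h1.add h2).congr_left fun z => ?_)
  simp [hby]
  ring

/-! ### Continuity of the coordinate densities. -/

section Continuity

variable {n : ℕ} {D S : Set (EuclideanSpace ℝ (Fin n))} {y : EuclideanSpace ℝ (Fin n)}
  {G₀ G : EuclideanSpace ℝ (Fin n) → Matrix (Fin n) (Fin n) ℝ}
  {f F : EuclideanSpace ℝ (Fin n) → ℝ}

theorem continuousOn_pd (hD : UniqueDiffOn ℝ D) (hf : ContDiffOn ℝ 1 f D) (i : Fin n) :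
    ContinuousOn (pd D i f) D :=
  (hf.continuousOn_fderivWithin hD le_rfl).clm_apply continuousOn_const

theorem contDiffOn_matrix_inv (hG : ∀ i j, ContDiffOn ℝ 1 (fun z => G z i j) D)
    (hdet : ∀ z ∈ D, IsUnit (G z).det) (i j : Fin n) :
    ContDiffOn ℝ 1 (fun z => (G z)⁻¹ i j) D :=
  fun z hz => contDiffWithinAt_matrix_inv (fun i j => hG i j z hz) (hdet z hz) i j

theorem continuousOn_christoffel (hD : UniqueDiffOn ℝ D)
    (hG : ∀ i j, ContDiffOn ℝ 1 (fun z => G z i j) D) (hdet : ∀ z ∈ D, IsUnit (G z).det)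
    (k i j : Fin n) : ContinuousOn (christoffel D G k i j) D := by
  unfold christoffel
  exact continuousOn_const.mul (continuousOn_finsetSum _ fun l _ =>
    (contDiffOn_matrix_inv hG hdet k l).continuousOn.mul
      (((continuousOn_pd hD (hG _ _) i).add (continuousOn_pd hD (hG _ _) j)).sub
        (continuousOn_pd hD (hG _ _) l)))

theorem continuousOn_covDerivTensor (hD : UniqueDiffOn ℝ D)
    (hG₀ : ∀ i j, ContDiffOn ℝ 1 (fun z => G₀ z i j) D) (hdet : ∀ z ∈ D, IsUnit (G₀ z).det)
    (hG : ∀ i j, ContDiffOn ℝ 1 (fun z => G z i j) D)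
    (i j k : Fin n) : ContinuousOn (covDerivTensor D G₀ G i j k) D := by
  unfold covDerivTensor
  exact ((continuousOn_pd hD (hG _ _) i).sub (continuousOn_finsetSum _ fun l _ =>
    (continuousOn_christoffel hD hG₀ hdet _ _ _).mul (hG _ _).continuousOn)).sub
    (continuousOn_finsetSum _ fun l _ =>
      (continuousOn_christoffel hD hG₀ hdet _ _ _).mul (hG _ _).continuousOn)

theorem continuousOn_gradNormSq
    (hG : ∀ i j, ContDiffOn ℝ 1 (fun z => G z i j) D) (hdet : ∀ z ∈ D, IsUnit (G z).det)
    (hF : ∀ j, ContinuousOn (pd D j F) D) : ContinuousOn (gradNormSq D G F) D := by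
  unfold gradNormSq
  exact continuousOn_finsetSum _ fun i _ => continuousOn_finsetSum _ fun j _ =>
    ((contDiffOn_matrix_inv hG hdet i j).continuousOn.mul (hF i)).mul (hF j)

/-- Two sets are needed: derivatives are taken within the domain `D`, while the division by `|dF|`
is justified only on `S`, later the boundary hypersurface. -/
theorem continuousOn_normal (hSD : S ⊆ D)
    (hG : ∀ i j, ContDiffOn ℝ 1 (fun z => G z i j) D) (hdet : ∀ z ∈ D, IsUnit (G z).det)
    (hF : ∀ j, ContinuousOn (pd D j F) D) (hpos : ∀ z ∈ S, 0 < gradNormSq D G F z) (k : Fin n) :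
    ContinuousOn (fun z => normal D G F z k) S := by
  unfold normal conormal
  exact continuousOn_finsetSum _ fun l _ =>
    ((contDiffOn_matrix_inv hG hdet k l).continuousOn.mono hSD).mul
      (((hF l).mono hSD).div ((continuousOn_gradNormSq hG hdet hF).mono hSD).sqrt
        fun z hz => (Real.sqrt_pos.2 (hpos z hz)).ne')

theorem continuousOn_massDensity (hSD : S ⊆ D) (hD : UniqueDiffOn ℝ D)
    (hG₀ : ∀ i j, ContDiffOn ℝ 1 (fun z => G₀ z i j) D) (hdet : ∀ z ∈ D, IsUnit (G₀ z).det)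
    (hG : ∀ i j, ContDiffOn ℝ 1 (fun z => G z i j) D)
    (hF : ∀ j, ContinuousOn (pd D j F) D) (hpos : ∀ z ∈ S, 0 < gradNormSq D G₀ F z) :
    ContinuousOn (massDensity D G₀ G F) S := by
  have hinv := contDiffOn_matrix_inv hG₀ hdet
  unfold massDensity
  refine continuousOn_finsetSum _ fun k _ =>
    ContinuousOn.mul (ContinuousOn.mono (t := S) ?_ hSD) (continuousOn_normal hSD hG₀ hdet hF hpos k)
  refine (continuousOn_finsetSum _ fun i _ => continuousOn_finsetSum _ fun j _ =>
    (hinv i j).continuousOn.mul (continuousOn_covDerivTensor hD hG₀ hdet hG i j k)).sub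
    (continuousOn_pd hD ?_ k)
  exact ContDiffOn.sum fun i _ => ContDiffOn.sum fun j _ => (hinv i j).mul (hG i j)

theorem continuousOn_surfaceDensity (hSD : S ⊆ D)
    (hG : ∀ i j, ContDiffOn ℝ 1 (fun z => G z i j) D) (hdet : ∀ z ∈ D, IsUnit (G z).det)
    (hF : ∀ j, ContinuousOn (pd D j F) D) (hne : ∀ z ∈ S, ∑ i, pd D i F z ^ 2 ≠ 0) :
    ContinuousOn (surfaceDensity D G F) S := by
  unfold surfaceDensity
  refine (ContinuousOn.mul ?_ (((continuousOn_gradNormSq hG hdet hF).mono hSD).div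
    (continuousOn_finsetSum _ fun i _ => ((hF i).mono hSD).pow 2) hne)).sqrt
  simp only [Matrix.det_apply']
  exact continuousOn_finsetSum _ fun σ _ => continuousOn_const.mul
    (continuousOn_finsetProd _ fun i _ => (hG _ _).continuousOn.mono hSD)

theorem gradNormSq_pos (hG : (G y).PosDef) (hF : ∃ i, pd D i F y ≠ 0) :
    0 < gradNormSq D G F y := by
  obtain ⟨i, hi⟩ := hF
  have := hG.inv.dotProduct_mulVec_pos (x := fun i => pd D i F y) fun h => hi (congrFun h i)
  rwa [star_trivial, dotProduct_inv_mulVec_pd] at this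

theorem surfaceDensity_congr (h : G y = G₀ y) :
    surfaceDensity D G F y = surfaceDensity D G₀ F y := by
  simp only [surfaceDensity, gradNormSq, h]

end Continuity

theorem sum_smul_single {n : ℕ} (v : EuclideanSpace ℝ (Fin n)) :
    ∑ a, v a • EuclideanSpace.single a (1 : ℝ) = v := by
  simpa using (EuclideanSpace.basisFun (Fin n) ℝ).sum_repr v

/-! ### Chart images, Jacobians and the components of bilinear forms. -/

section Charts

variable {n : ℕ} [NeZero n] {X : Type*} [TopologicalSpace X]
  [ChartedSpace (EuclideanHalfSpace n) X]
  {p q x : X} {y : EuclideanSpace ℝ (Fin n)}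

theorem mem_coordDom {S : Set X} (hx : x ∈ S) (hp : x ∈ (extChartAt (𝓡∂ n) p).source) :
    extChartAt (𝓡∂ n) p x ∈ coordDom S p :=
  ⟨(extChartAt (𝓡∂ n) p).map_source hp, by
    rwa [mem_preimage, (extChartAt (𝓡∂ n) p).left_inv hp]⟩

variable [IsManifold (𝓡∂ n) ∞ X]

/-- Being an interior point can be tested in any chart. Consequently the interior of `X` has open
chart images, on which ordinary derivatives are available. -/
theorem coordDom_interior (p : X) :
    coordDom ((𝓡∂ n).interior X) p = interior (extChartAt (𝓡∂ n) p).target := by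
  have key : ∀ y ∈ (extChartAt (𝓡∂ n) p).target,
      ((extChartAt (𝓡∂ n) p).symm y ∈ (𝓡∂ n).interior X ↔
        y ∈ interior (extChartAt (𝓡∂ n) p).target) := by
    intro y hy
    have hs : (extChartAt (𝓡∂ n) p).symm y ∈ (chartAt (EuclideanHalfSpace n) p).source := by
      rw [← extChartAt_source (𝓡∂ n)]; exact (extChartAt (𝓡∂ n) p).map_target hy
    have := (𝓡∂ n).isInteriorPoint_iff_of_mem_atlas (n := ∞) (by simp)
      (chart_mem_atlas (EuclideanHalfSpace n) p) hs
    have hr : ((chartAt (EuclideanHalfSpace n) p).extend (𝓡∂ n))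
        ((extChartAt (𝓡∂ n) p).symm y) = y := (extChartAt (𝓡∂ n) p).right_inv hy
    rw [hr] at this
    exact this
  ext y
  exact ⟨fun h => (key y h.1).1 h.2,
    fun h => ⟨interior_subset h, (key y (interior_subset h)).2 h⟩⟩

theorem isOpen_coordDom_interior (p : X) : IsOpen (coordDom (n := n) ((𝓡∂ n).interior X) p) := by
  rw [coordDom_interior]; exact isOpen_interior

/-- The Jacobian of the change of charts from `p` to `q` at `x`. -/
def chartJacobian (p q x : X) : Matrix (Fin n) (Fin n) ℝ :=
  Matrix.of fun a i => tangentCoordChange (𝓡∂ n) p q x (EuclideanSpace.single i 1) a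

theorem tangentCoordChange_single (p q x : X) (i : Fin n) :
    tangentCoordChange (𝓡∂ n) p q x (EuclideanSpace.single i 1) =
      ∑ a, chartJacobian p q x a i • EuclideanSpace.single a (1 : ℝ) :=
  (sum_smul_single _).symm

theorem chartJacobian_mul (hp : x ∈ (extChartAt (𝓡∂ n) p).source)
    (hq : x ∈ (extChartAt (𝓡∂ n) q).source) :
    chartJacobian (n := n) q p x * chartJacobian p q x = 1 := by
  ext a i
  have h1 : tangentCoordChange (𝓡∂ n) q p x (tangentCoordChange (𝓡∂ n) p q x
      (EuclideanSpace.single i 1)) = EuclideanSpace.single i (1 : ℝ) := by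
    rw [tangentCoordChange_comp ⟨⟨hp, hq⟩, hp⟩, tangentCoordChange_self hp]
  rw [tangentCoordChange_single p q, map_sum] at h1
  have h2 := congrArg (fun v : EuclideanSpace ℝ (Fin n) => v a) h1
  simp only [map_smul, PiLp.single_apply] at h2
  rw [Matrix.mul_apply, Matrix.one_apply, ← h2]
  simp [chartJacobian, mul_comm]

theorem isUnit_det_chartJacobian (hp : x ∈ (extChartAt (𝓡∂ n) p).source)
    (hq : x ∈ (extChartAt (𝓡∂ n) q).source) :
    IsUnit (chartJacobian (n := n) p q x).det := by
  have h := congrArg Matrix.det (chartJacobian_mul (n := n) hp hq)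
  rw [Matrix.det_mul, Matrix.det_one] at h
  exact IsUnit.of_mul_eq_one_right _ h

theorem gram_extChartAt (g : TwoTensor n X) (hp : x ∈ (extChartAt (𝓡∂ n) p).source) (i j : Fin n) :
    gram g p (extChartAt (𝓡∂ n) p x) i j =
      g x (tangentCoordChange (𝓡∂ n) p x x (EuclideanSpace.single i 1))
        (tangentCoordChange (𝓡∂ n) p x x (EuclideanSpace.single j 1)) := by
  -- The base point occurs in the types of the tangent vectors, so it is generalised and substituted
  -- instead of rewritten.
  have h := (extChartAt (𝓡∂ n) p).left_inv hp
  simp only [gram, coordVec, Matrix.of_apply]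
  generalize (extChartAt (𝓡∂ n) p).symm (extChartAt (𝓡∂ n) p x) = z at h
  subst h
  rfl

/-- The components of a bilinear form transform as a tensor. -/
theorem gram_chart_change (g : TwoTensor n X) (hp : x ∈ (extChartAt (𝓡∂ n) p).source)
    (hq : x ∈ (extChartAt (𝓡∂ n) q).source) :
    gram g p (extChartAt (𝓡∂ n) p x) =
      (chartJacobian p q x).transpose * gram g q (extChartAt (𝓡∂ n) q x) * chartJacobian p q x := by
  ext i j
  have hx : x ∈ (extChartAt (𝓡∂ n) x).source := mem_extChartAt_source x
  have h1 : ∀ i, tangentCoordChange (𝓡∂ n) p x x (EuclideanSpace.single i 1) =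
      ∑ a, chartJacobian p q x a i •
        tangentCoordChange (𝓡∂ n) q x x (EuclideanSpace.single a (1 : ℝ)) := fun i => by
    rw [← tangentCoordChange_comp ⟨⟨hp, hq⟩, hx⟩, tangentCoordChange_single p q, map_sum]
    simp only [map_smul]
  have h2 : ∀ (s t : Fin n → ℝ) (u v : Fin n → EuclideanSpace ℝ (Fin n))
      (B : EuclideanSpace ℝ (Fin n) →L[ℝ] EuclideanSpace ℝ (Fin n) →L[ℝ] ℝ),
      B (∑ a, s a • u a) (∑ b, t b • v b) = ∑ b, (∑ a, s a * B (u a) (v b)) * t b := by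
    intro s t u v B
    simp only [map_sum, map_smul, _root_.sum_apply, _root_.smul_apply,
      smul_eq_mul]
    exact Finset.sum_congr rfl fun b _ => mul_comm _ _
  rw [gram_extChartAt g hp, h1, h1, Matrix.mul_apply]
  refine (h2 _ _ _ _ _).trans (Finset.sum_congr rfl fun b _ => ?_)
  rw [Matrix.mul_apply]
  congr 1
  refine Finset.sum_congr rfl fun a _ => ?_
  rw [gram_extChartAt g hq]
  rfl

theorem gram_posDef {S : Set X} {g : TwoTensor n X} (hg : IsInnerOn S g) (hy : y ∈ coordDom S p) :
    (gram g p y).PosDef := by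
  obtain ⟨hyt, hyS⟩ := hy
  set x := (extChartAt (𝓡∂ n) p).symm y with hx
  have hp : x ∈ (extChartAt (𝓡∂ n) p).source := (extChartAt (𝓡∂ n) p).map_target hyt
  have hyx : y = extChartAt (𝓡∂ n) p x := ((extChartAt (𝓡∂ n) p).right_inv hyt).symm
  have hpos := (hg x hyS).2
  have hsymm := (hg x hyS).1
  rw [hyx]
  refine Matrix.PosDef.of_dotProduct_mulVec_pos ?_ ?_
  · ext i j
    rw [Matrix.conjTranspose_apply, star_trivial, gram_extChartAt g hp, gram_extChartAt g hp]
    exact hsymm _ _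
  · intro v hv
    set V : EuclideanSpace ℝ (Fin n) := ∑ i, v i • EuclideanSpace.single i (1 : ℝ) with hV
    have hVv : ∀ i, V i = v i := fun i => by
      have := sum_smul_single (WithLp.toLp 2 v)
      exact congrArg (fun u : EuclideanSpace ℝ (Fin n) => u i) this
    -- The coordinate change is invertible on tangent vectors, so positivity of `g x` can be applied
    -- to the image of `V`.
    have hne : tangentCoordChange (𝓡∂ n) p x x V ≠ 0 := by
      intro h0
      have h1 : tangentCoordChange (𝓡∂ n) x p x (tangentCoordChange (𝓡∂ n) p x x V) = V := by
        rw [tangentCoordChange_comp ⟨⟨hp, mem_extChartAt_source x⟩, hp⟩, tangentCoordChange_self hp]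
      rw [h0, map_zero] at h1
      exact hv (funext fun i => by rw [← hVv, ← h1]; rfl)
    have h2 : ∀ (u : Fin n → EuclideanSpace ℝ (Fin n))
        (B : EuclideanSpace ℝ (Fin n) →L[ℝ] EuclideanSpace ℝ (Fin n) →L[ℝ] ℝ),
        B (∑ a, v a • u a) (∑ b, v b • u b) = ∑ a, v a * ∑ b, B (u a) (u b) * v b := by
      intro u B
      simp only [map_sum, map_smul, _root_.sum_apply, _root_.smul_apply,
        smul_eq_mul, Finset.mul_sum]
      rw [Finset.sum_comm]
      exact Finset.sum_congr rfl fun a _ => Finset.sum_congr rfl fun b _ => by ring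
    have h3 := hpos _ hne
    rw [hV, map_sum] at h3
    simp only [map_smul] at h3
    have h4 := h2 (fun i => tangentCoordChange (𝓡∂ n) p x x (EuclideanSpace.single i 1)) (g x)
    simp only [star_trivial, dotProduct, Matrix.mulVec, gram_extChartAt g hp]
    exact h3.trans_eq h4

theorem isUnit_det_gram {S : Set X} {g : TwoTensor n X} (hg : IsInnerOn S g)
    (hy : y ∈ coordDom S p) : IsUnit (gram g p y).det :=
  (gram_posDef hg hy).det_pos.ne'.isUnit

theorem gram_symm {S : Set X} {g : TwoTensor n X} (hg : IsInnerOn S g)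
    (hy : y ∈ coordDom S p) (i j : Fin n) : gram g p y i j = gram g p y j i :=
  (hg _ hy.2).1 _ _

theorem gram_congr {g g' : TwoTensor n X} {S : Set X} (h : ∀ x ∈ S, g x = g' x)
    (hy : y ∈ coordDom S p) : gram g p y = gram g' p y := by
  ext i j
  simp only [gram, Matrix.of_apply, h _ hy.2]

end Charts

/-! ### The boundary hypersurfaces in charts and chart independence of the density. -/

section Level

variable {n : ℕ} [NeZero n] {X : Type*} [TopologicalSpace X]
  [ChartedSpace (EuclideanHalfSpace n) X]
  {e : Exhaustion n X} {r : ℝ} {g₀ g : TwoTensor n X} {p q x : X} {y : EuclideanSpace ℝ (Fin n)}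

/-- The level function in the chart at `p`. -/
abbrev Exhaustion.coordLevel (e : Exhaustion n X) (p : X) : EuclideanSpace ℝ (Fin n) → ℝ :=
  e.level ∘ (extChartAt (𝓡∂ n) p).symm

theorem Exhaustion.coordDom_dom (e : Exhaustion n X) (r : ℝ) (p : X) :
    coordDom (e.dom r) p = {z ∈ coordDom ((𝓡∂ n).interior X) p | e.coordLevel p z ≤ r} := by
  ext z
  exact ⟨fun h => ⟨⟨h.1, h.2.1⟩, h.2.2⟩, fun h => ⟨h.1.1, h.1.2, h.2⟩⟩

theorem Exhaustion.coordDom_bdry (e : Exhaustion n X) (r : ℝ) (p : X) :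
    coordDom (e.bdry r) p = {z ∈ coordDom ((𝓡∂ n).interior X) p | e.coordLevel p z = r} := by
  ext z
  exact ⟨fun h => ⟨⟨h.1, h.2.1⟩, h.2.2⟩, fun h => ⟨h.1.1, h.1.2, h.2⟩⟩

theorem Exhaustion.coordDom_bdry_subset (e : Exhaustion n X) (r : ℝ) (p : X) :
    coordDom (n := n) (e.bdry r) p ⊆ coordDom (e.dom r) p :=
  fun _ h => ⟨h.1, h.2.1, h.2.2.le⟩

theorem Exhaustion.isCompact_bdry [T2Space X] (e : Exhaustion n X) (hr : e.start ≤ r) :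
    IsCompact (e.bdry r) := by
  have hc := e.isCompact r hr
  have hcont : ContinuousOn e.level {x ∈ (𝓡∂ n).interior X | e.level x ≤ r} :=
    e.smooth.continuousOn.mono fun x hx => hx.1
  have h := hcont.preimage_isClosed_of_isClosed hc.isClosed (isClosed_singleton (x := r))
  have : e.bdry r = {x ∈ (𝓡∂ n).interior X | e.level x ≤ r} ∩ e.level ⁻¹' {r} := by
    ext x
    exact ⟨fun hx => ⟨⟨hx.1, hx.2.le⟩, hx.2⟩, fun hx => ⟨hx.1.1, hx.2⟩⟩
  rw [this]
  exact hc.of_isClosed_subset h inter_subset_left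

variable [IsManifold (𝓡∂ n) ∞ X]

theorem Exhaustion.contDiffOn_coordLevel (e : Exhaustion n X) (p : X) :
    ContDiffOn ℝ ∞ (e.coordLevel p) (coordDom ((𝓡∂ n).interior X) p) := by
  rw [← contMDiffOn_iff_contDiffOn]
  exact e.smooth.comp ((contMDiffOn_extChartAt_symm p).mono fun z hz => hz.1) fun z hz => hz.2

theorem Exhaustion.contDiffAt_coordLevel (e : Exhaustion n X)
    (hy : y ∈ coordDom ((𝓡∂ n).interior X) p) : ContDiffAt ℝ ∞ (e.coordLevel p) y :=
  (e.contDiffOn_coordLevel p).contDiffAt ((isOpen_coordDom_interior p).mem_nhds hy)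

theorem Exhaustion.hasStrictFDerivAt_coordLevel (e : Exhaustion n X)
    (hy : y ∈ coordDom ((𝓡∂ n).interior X) p) :
    HasStrictFDerivAt (e.coordLevel p) (fderiv ℝ (e.coordLevel p) y) y :=
  (e.contDiffAt_coordLevel hy).hasStrictFDerivAt (by simp)

/-- Regularity is assumed on the manifold; near `x` the level function factors through the chart, so
the chain rule transfers it to coordinates. -/
theorem Exhaustion.fderiv_coordLevel_ne_zero (e : Exhaustion n X)
    (hy : y ∈ coordDom ((𝓡∂ n).interior X) p) (hr : e.start ≤ e.coordLevel p y) :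
    fderiv ℝ (e.coordLevel p) y ≠ 0 := by
  intro h0
  set x := (extChartAt (𝓡∂ n) p).symm y with hx
  have hp : x ∈ (extChartAt (𝓡∂ n) p).source := (extChartAt (𝓡∂ n) p).map_target hy.1
  refine e.regular x hy.2 hr ?_
  have hyx : extChartAt (𝓡∂ n) p x = y := (extChartAt (𝓡∂ n) p).right_inv hy.1
  have heq : e.level =ᶠ[𝓝 x] e.coordLevel p ∘ extChartAt (𝓡∂ n) p := by
    filter_upwards [(isOpen_extChartAt_source p).mem_nhds hp] with z hz
    exact congrArg e.level ((extChartAt (𝓡∂ n) p).left_inv hz).symm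
  have hc : MDifferentiableAt (𝓡∂ n) 𝓘(ℝ, EuclideanSpace ℝ (Fin n)) (extChartAt (𝓡∂ n) p) x := by
    rw [extChartAt_source] at hp
    exact (contMDiffAt_extChartAt' (n := ∞) hp).mdifferentiableAt (by simp)
  have hF : MDifferentiableAt 𝓘(ℝ, EuclideanSpace ℝ (Fin n)) 𝓘(ℝ, ℝ) (e.coordLevel p)
      (extChartAt (𝓡∂ n) p x) := by
    rw [mdifferentiableAt_iff_differentiableAt, hyx]
    exact (e.hasStrictFDerivAt_coordLevel hy).differentiableAt
  rw [heq.mfderiv_eq, mfderiv_comp x hF hc, mfderiv_eq_fderiv, hyx, h0]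
  exact ContinuousLinearMap.zero_comp _

theorem Exhaustion.uniqueDiffOn (e : Exhaustion n X) (hr : e.start ≤ r) (p : X) :
    UniqueDiffOn ℝ (coordDom (n := n) (e.dom r) p) := by
  intro y hy
  have hyi : y ∈ coordDom ((𝓡∂ n).interior X) p := ⟨hy.1, hy.2.1⟩
  rw [e.coordDom_dom]
  exact uniqueDiffWithinAt_sublevel ((isOpen_coordDom_interior p).mem_nhds hyi) hy.2.2
    (e.hasStrictFDerivAt_coordLevel hyi).hasFDerivAt
    fun h => e.fderiv_coordLevel_ne_zero hyi (hr.trans_eq h.symm)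

theorem Exhaustion.contDiffOn_coordLevel_dom (e : Exhaustion n X) (r : ℝ) (p : X) :
    ContDiffOn ℝ 1 (e.coordLevel p) (coordDom (e.dom r) p) :=
  ((e.contDiffOn_coordLevel p).of_le (by simp)).mono fun _ h => ⟨h.1, h.2.1⟩

theorem Exhaustion.pd_coordLevel (e : Exhaustion n X) (hr : e.start ≤ r)
    (hy : y ∈ coordDom (e.dom r) p) (i : Fin n) :
    pd (coordDom (e.dom r) p) i (e.coordLevel p) y =
      fderiv ℝ (e.coordLevel p) y (EuclideanSpace.single i 1) :=
  (e.hasStrictFDerivAt_coordLevel ⟨hy.1, hy.2.1⟩).hasFDerivAt.hasFDerivWithinAt.pd_eq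
    (e.uniqueDiffOn hr p y hy) i

theorem Exhaustion.exists_pd_coordLevel_ne_zero (e : Exhaustion n X) (hr : e.start ≤ r)
    (hy : y ∈ coordDom (e.bdry r) p) :
    ∃ i, pd (coordDom (e.dom r) p) i (e.coordLevel p) y ≠ 0 := by
  by_contra! H
  refine e.fderiv_coordLevel_ne_zero (p := p) (y := y) ⟨hy.1, hy.2.1⟩ (hr.trans_eq hy.2.2.symm) ?_
  ext v
  rw [← sum_smul_single v, map_sum, map_sum]
  refine Finset.sum_congr rfl fun i _ => ?_
  rw [map_smul, ← e.pd_coordLevel hr (e.coordDom_bdry_subset r p hy), H, smul_zero]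
  rfl

theorem Exhaustion.differentiableWithinAt_pd (e : Exhaustion n X) (hr : e.start ≤ r)
    (hy : y ∈ coordDom (e.dom r) p) (i : Fin n) :
    DifferentiableWithinAt ℝ (pd (coordDom (e.dom r) p) i (e.coordLevel p))
      (coordDom (e.dom r) p) y := by
  have h1 : DifferentiableAt ℝ (fderiv ℝ (e.coordLevel p)) y :=
    ((e.contDiffAt_coordLevel ⟨hy.1, hy.2.1⟩).fderiv_right (m := 1)
      (by norm_cast)).differentiableAt one_ne_zero
  have h2 : DifferentiableAt ℝ
      (fun z => fderiv ℝ (e.coordLevel p) z (EuclideanSpace.single i 1)) y :=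
    h1.clm_apply (differentiableAt_const _)
  exact h2.differentiableWithinAt.congr (fun z hz => e.pd_coordLevel hr hz i)
    (e.pd_coordLevel hr hy i)

theorem Exhaustion.gradNormSq_pos (e : Exhaustion n X) (hr : e.start ≤ r)
    (hg : IsInnerOn (e.dom r) g) (hy : y ∈ coordDom (e.bdry r) p) :
    0 < gradNormSq (coordDom (e.dom r) p) (gram g p) (e.coordLevel p) y :=
  APE.gradNormSq_pos (gram_posDef hg (e.coordDom_bdry_subset r p hy))
    (e.exists_pd_coordLevel_ne_zero hr hy)

theorem hasFDerivWithinAt_gram_sub {S : Set X} (hg₀ : IsMetricOn S g₀)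
    (hg : IsMetricOn S g) (hy : y ∈ coordDom S p) (i j : Fin n) :
    HasFDerivWithinAt (fun z => gram g p z i j - gram g₀ p z i j)
      (fderivWithin ℝ (fun z => gram g p z i j - gram g₀ p z i j) (coordDom S p) y)
      (coordDom S p) y :=
  (((hg.2 p i j y hy).differentiableWithinAt one_ne_zero).fun_sub
    ((hg₀.2 p i j y hy).differentiableWithinAt one_ne_zero)).hasFDerivWithinAt

/-- To first order at the boundary, the difference of two metrics which agree on the boundary is a
multiple of the differential of the level function. -/
theorem Exhaustion.exists_hasFDerivWithinAt_gram_sub (e : Exhaustion n X) (hr : e.start ≤ r)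
    (hg₀ : IsMetricOn (e.dom r) g₀) (hg : IsMetricOn (e.dom r) g)
    (heq : ∀ x ∈ e.bdry r, g x = g₀ x) (hy : y ∈ coordDom (e.bdry r) p) :
    ∃ c : Matrix (Fin n) (Fin n) ℝ, ∀ i j,
      HasFDerivWithinAt (fun z => gram g p z i j - gram g₀ p z i j)
        (c i j • fderiv ℝ (e.coordLevel p) y) (coordDom (e.dom r) p) y := by
  have hyD := e.coordDom_bdry_subset r p hy
  have hyi : y ∈ coordDom ((𝓡∂ n).interior X) p := ⟨hy.1, hy.2.1⟩
  have hne := e.fderiv_coordLevel_ne_zero hyi (hr.trans_eq hy.2.2.symm)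
  obtain ⟨w, hw⟩ := exists_apply_eq_one hne
  have hyr : e.coordLevel p y = r := hy.2.2
  have hbd : ∀ᶠ z in 𝓝 y, e.coordLevel p z = e.coordLevel p y → z ∈ coordDom (e.bdry r) p := by
    filter_upwards [(isOpen_coordDom_interior p).mem_nhds hyi] with z hz hzy
    rw [e.coordDom_bdry]
    exact ⟨hz, hzy.trans hyr⟩
  -- The coefficient is the derivative of `g - g₀` in a transversal direction `w` normalised by
  -- `dF(w) = 1`.
  refine ⟨Matrix.of fun i j => fderivWithin ℝ (fun z => gram g p z i j - gram g₀ p z i j)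
    (coordDom (e.dom r) p) y w, fun i j => ?_⟩
  have hd := hasFDerivWithinAt_gram_sub hg₀ hg hyD i j
  rw [Matrix.of_apply, ← eq_smul_of_vanish_on_level (e.hasStrictFDerivAt_coordLevel hyi) hne hd
    (hbd.mono fun z hz hzy => ⟨e.coordDom_bdry_subset r p (hz hzy), by
      simp [gram_congr heq (hz hzy)]⟩) hw]
  exact hd

theorem Exhaustion.agreeOnLevel (e : Exhaustion n X) (hr : e.start ≤ r)
    (hg₀ : IsMetricOn (e.dom r) g₀) (hg : IsMetricOn (e.dom r) g)
    (heq : ∀ x ∈ e.bdry r, g x = g₀ x) (hy : y ∈ coordDom (e.bdry r) p)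
    {c : Matrix (Fin n) (Fin n) ℝ} (hc : ∀ i j,
      HasFDerivWithinAt (fun z => gram g p z i j - gram g₀ p z i j)
        (c i j • fderiv ℝ (e.coordLevel p) y) (coordDom (e.dom r) p) y) :
    AgreeOnLevel (coordDom (e.dom r) p) (gram g₀ p) (gram g p) (e.coordLevel p) c y := by
  have hyD := e.coordDom_bdry_subset r p hy
  have hD := e.uniqueDiffOn hr p y hyD
  refine ⟨hyD, hD, fun i j => hg₀.2 p i j y hyD, fun i j => hg.2 p i j y hyD,
    fun z hz => isUnit_det_gram hg₀.1 hz, fun z hz => gram_symm hg₀.1 hz, gram_congr heq hy,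
    fun j => e.differentiableWithinAt_pd hr hyD j, e.gradNormSq_pos hr hg₀.1 hy, fun k i j => ?_⟩
  rw [← APE.pd_sub hD ((hg.2 p i j y hyD).differentiableWithinAt one_ne_zero)
    ((hg₀.2 p i j y hyD).differentiableWithinAt one_ne_zero), (hc i j).pd_eq hD,
    e.pd_coordLevel hr hyD]
  rfl

theorem hasFDerivAt_chart_change (hx : x ∈ (𝓡∂ n).interior X)
    (hp : x ∈ (extChartAt (𝓡∂ n) p).source) (hq : x ∈ (extChartAt (𝓡∂ n) q).source) :
    HasFDerivAt (extChartAt (𝓡∂ n) q ∘ (extChartAt (𝓡∂ n) p).symm)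
      (tangentCoordChange (𝓡∂ n) p q x) (extChartAt (𝓡∂ n) p x) := by
  refine (hasFDerivWithinAt_tangentCoordChange ⟨hp, hq⟩).hasFDerivAt ?_
  have h := mem_coordDom hx hp
  rw [coordDom_interior, mem_interior_iff_mem_nhds] at h
  exact mem_of_superset h (extChartAt_target_subset_range p)

theorem Exhaustion.fderiv_coordLevel_chart_change (e : Exhaustion n X)
    (hx : x ∈ (𝓡∂ n).interior X)
    (hp : x ∈ (extChartAt (𝓡∂ n) p).source) (hq : x ∈ (extChartAt (𝓡∂ n) q).source) :
    fderiv ℝ (e.coordLevel p) (extChartAt (𝓡∂ n) p x) =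
      fderiv ℝ (e.coordLevel q) (extChartAt (𝓡∂ n) q x) ∘L tangentCoordChange (𝓡∂ n) p q x := by
  have hτ := hasFDerivAt_chart_change hx hp hq
  have hx' := (extChartAt (𝓡∂ n) p).left_inv hp
  have h1 : HasFDerivAt (e.coordLevel q) (fderiv ℝ (e.coordLevel q) (extChartAt (𝓡∂ n) q x))
      ((extChartAt (𝓡∂ n) q ∘ (extChartAt (𝓡∂ n) p).symm) (extChartAt (𝓡∂ n) p x)) := by
    rw [Function.comp_apply, hx']
    exact (e.hasStrictFDerivAt_coordLevel (mem_coordDom hx hq)).hasFDerivAt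
  refine ((h1.comp _ hτ).congr_of_eventuallyEq ?_).fderiv
  have hsrc : ∀ᶠ z in 𝓝 (extChartAt (𝓡∂ n) p x),
      (extChartAt (𝓡∂ n) p).symm z ∈ (extChartAt (𝓡∂ n) q).source := by
    refine (continuousAt_extChartAt_symm' hp).preimage_mem_nhds ?_
    rw [hx']
    exact (isOpen_extChartAt_source q).mem_nhds hq
  filter_upwards [hsrc] with z hz
  exact congrArg e.level ((extChartAt (𝓡∂ n) q).left_inv hz).symm

/-- First derivatives of tensor components normally pick up derivatives of the Jacobian. Here these
multiply `g - g₀ = 0`, so continuity of the Jacobian suffices and `c` itself transforms as a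
bilinear form. -/
theorem Exhaustion.hasFDerivWithinAt_gram_sub_chart_change (e : Exhaustion n X)
    (heq : ∀ x ∈ e.bdry r, g x = g₀ x) (hx : x ∈ e.bdry r)
    (hp : x ∈ (extChartAt (𝓡∂ n) p).source) (hq : x ∈ (extChartAt (𝓡∂ n) q).source)
    {c : Matrix (Fin n) (Fin n) ℝ} (hc : ∀ i j,
      HasFDerivWithinAt (fun z => gram g q z i j - gram g₀ q z i j)
        (c i j • fderiv ℝ (e.coordLevel q) (extChartAt (𝓡∂ n) q x)) (coordDom (e.dom r) q)
        (extChartAt (𝓡∂ n) q x)) (i j : Fin n) :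
    HasFDerivWithinAt (fun z => gram g p z i j - gram g₀ p z i j)
      (((chartJacobian p q x).transpose * c * chartJacobian p q x : Matrix (Fin n) (Fin n) ℝ) i j •
        fderiv ℝ (e.coordLevel p) (extChartAt (𝓡∂ n) p x)) (coordDom (e.dom r) p)
        (extChartAt (𝓡∂ n) p x) := by
  set y := extChartAt (𝓡∂ n) p x with hy
  set τ := extChartAt (𝓡∂ n) q ∘ (extChartAt (𝓡∂ n) p).symm with hτdef
  have hx' : (extChartAt (𝓡∂ n) p).symm y = x := (extChartAt (𝓡∂ n) p).left_inv hp
  have hτ := hasFDerivAt_chart_change hx.1 hp hq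
  rw [← hτdef, ← hy] at hτ
  have hτy : τ y = extChartAt (𝓡∂ n) q x := by rw [hτdef, Function.comp_apply, hx']
  have hcont : ContinuousAt (extChartAt (𝓡∂ n) p).symm y := continuousAt_extChartAt_symm' hp
  have hsrc : ∀ᶠ z in 𝓝 y, (extChartAt (𝓡∂ n) p).symm z ∈ (extChartAt (𝓡∂ n) q).source :=
    hcont.preimage_mem_nhds (by
      rw [hx']; exact (isOpen_extChartAt_source q).mem_nhds hq)
  -- On `W` both charts are defined, and shrinking to it does not change the neighbourhood filter at
  -- `y`.
  set W : Set (EuclideanSpace ℝ (Fin n)) :=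
    coordDom (e.dom r) p ∩ (extChartAt (𝓡∂ n) p).symm ⁻¹' (extChartAt (𝓡∂ n) q).source with hW
  have hWn : 𝓝[coordDom (e.dom r) p] y = 𝓝[W] y := by
    rw [hW, nhdsWithin_inter_of_mem']
    exact nhdsWithin_le_nhds hsrc
  have hpW : ∀ z ∈ W, (extChartAt (𝓡∂ n) p).symm z ∈ (extChartAt (𝓡∂ n) p).source :=
    fun z hz => (extChartAt (𝓡∂ n) p).map_target hz.1.1
  have hyW : y ∈ W := ⟨mem_coordDom ⟨hx.1, hx.2.le⟩ hp, by rwa [mem_preimage, hx']⟩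
  have hmaps : MapsTo τ W (coordDom (e.dom r) q) := fun z hz => mem_coordDom hz.1.2 hz.2
  have hJ : ∀ a i, ContinuousWithinAt
      (fun z => chartJacobian (n := n) p q ((extChartAt (𝓡∂ n) p).symm z) a i) W y := by
    intro a i
    have h1 : ContinuousAt (tangentCoordChange (𝓡∂ n) p q) ((extChartAt (𝓡∂ n) p).symm y) := by
      rw [hx']
      exact (continuousOn_tangentCoordChange p q).continuousAt
        (((isOpen_extChartAt_source p).inter (isOpen_extChartAt_source q)).mem_nhds ⟨hp, hq⟩)
    have h2 := (ContinuousAt.comp (f := (extChartAt (𝓡∂ n) p).symm) h1 hcont).clm_apply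
      (continuousAt_const (y := EuclideanSpace.single i (1 : ℝ)))
    exact ((EuclideanSpace.proj a).continuous.continuousAt.comp h2).continuousWithinAt
  have hterm : ∀ a b, HasFDerivWithinAt
      (fun z => (chartJacobian p q ((extChartAt (𝓡∂ n) p).symm z) a i *
        chartJacobian p q ((extChartAt (𝓡∂ n) p).symm z) b j) *
        (gram g q (τ z) a b - gram g₀ q (τ z) a b))
      ((chartJacobian p q x a i * chartJacobian p q x b j * c a b) •
        fderiv ℝ (e.coordLevel p) y) W y := by
    intro a b
    have h1 : HasFDerivWithinAt (fun z => gram g q (τ z) a b - gram g₀ q (τ z) a b)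
        ((c a b • fderiv ℝ (e.coordLevel q) (extChartAt (𝓡∂ n) q x)) ∘L
          tangentCoordChange (𝓡∂ n) p q x) W y := by
      have := hc a b
      rw [← hτy] at this ⊢
      exact HasFDerivWithinAt.comp y this hτ.hasFDerivWithinAt hmaps
    have h2 := hasFDerivWithinAt_mul_of_eq_zero ((hJ a i).fun_mul (hJ b j)) h1 (by
      rw [hτy, gram_congr heq (mem_coordDom hx hq), sub_self])
    rw [hx', ContinuousLinearMap.smul_comp,
      ← e.fderiv_coordLevel_chart_change hx.1 hp hq, smul_smul] at h2
    exact h2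
  have hsum := HasFDerivWithinAt.fun_sum (u := Finset.univ) fun (b : Fin n) _ =>
    HasFDerivWithinAt.fun_sum (u := Finset.univ) fun (a : Fin n) _ => hterm a b
  have hgram : ∀ z ∈ W, gram g p z i j - gram g₀ p z i j =
      ∑ b, ∑ a, (chartJacobian p q ((extChartAt (𝓡∂ n) p).symm z) a i *
        chartJacobian p q ((extChartAt (𝓡∂ n) p).symm z) b j) *
        (gram g q (τ z) a b - gram g₀ q (τ z) a b) := by
    intro z hz
    have h1 : ∀ g : TwoTensor n X, gram g p z i j =
        ∑ b, ∑ a, (chartJacobian p q ((extChartAt (𝓡∂ n) p).symm z) a i *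
          chartJacobian p q ((extChartAt (𝓡∂ n) p).symm z) b j) * gram g q (τ z) a b := by
      intro g
      have h2 := gram_chart_change g (hpW z hz) hz.2
      rw [(extChartAt (𝓡∂ n) p).right_inv hz.1.1] at h2
      rw [h2, Matrix.mul_apply]
      refine Finset.sum_congr rfl fun b _ => ?_
      rw [Matrix.mul_apply, Finset.sum_mul]
      exact Finset.sum_congr rfl fun a _ => by
        rw [Matrix.transpose_apply, hτdef, Function.comp_apply]; ring
    rw [h1, h1, ← Finset.sum_sub_distrib]
    refine Finset.sum_congr rfl fun b _ => ?_
    rw [← Finset.sum_sub_distrib]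
    exact Finset.sum_congr rfl fun a _ => by ring
  have hres := hsum.congr hgram (hgram y hyW)
  simp only [← Finset.sum_smul] at hres
  have hcoef : ((chartJacobian p q x).transpose * c * chartJacobian p q x :
      Matrix (Fin n) (Fin n) ℝ) i j =
      ∑ b, ∑ a, chartJacobian p q x a i * chartJacobian p q x b j * c a b := by
    rw [Matrix.mul_apply]
    refine Finset.sum_congr rfl fun b _ => ?_
    rw [Matrix.mul_apply, Finset.sum_mul]
    exact Finset.sum_congr rfl fun a _ => by rw [Matrix.transpose_apply]; ring
  rw [hcoef]
  exact hres.mono_of_mem_nhdsWithin (by rw [hWn]; exact self_mem_nhdsWithin)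

/-- The mass density does not depend on the chart. -/
theorem Exhaustion.massDensity_chart_change (e : Exhaustion n X) (hr : e.start ≤ r)
    (hg₀ : IsMetricOn (e.dom r) g₀) (hg : IsMetricOn (e.dom r) g)
    (heq : ∀ x ∈ e.bdry r, g x = g₀ x) (hx : x ∈ e.bdry r)
    (hp : x ∈ (extChartAt (𝓡∂ n) p).source) (hq : x ∈ (extChartAt (𝓡∂ n) q).source) :
    massDensity (coordDom (e.dom r) p) (gram g₀ p) (gram g p) (e.coordLevel p)
      (extChartAt (𝓡∂ n) p x) =
    massDensity (coordDom (e.dom r) q) (gram g₀ q) (gram g q) (e.coordLevel q)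
      (extChartAt (𝓡∂ n) q x) := by
  obtain ⟨c, hc⟩ := e.exists_hasFDerivWithinAt_gram_sub hr hg₀ hg heq (mem_coordDom hx hq)
  have hxd : x ∈ e.dom r := ⟨hx.1, hx.2.le⟩
  have hw : (fun i => pd (coordDom (e.dom r) p) i (e.coordLevel p) (extChartAt (𝓡∂ n) p x)) =
      (chartJacobian p q x).transpose.mulVec fun i =>
        pd (coordDom (e.dom r) q) i (e.coordLevel q) (extChartAt (𝓡∂ n) q x) := by
    funext i
    rw [e.pd_coordLevel hr (mem_coordDom hxd hp), e.fderiv_coordLevel_chart_change hx.1 hp hq,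
      ContinuousLinearMap.comp_apply, tangentCoordChange_single, map_sum]
    simp only [Matrix.mulVec, dotProduct, Matrix.transpose_apply, map_smul, smul_eq_mul,
      e.pd_coordLevel hr (mem_coordDom hxd hq)]
  rw [(e.agreeOnLevel hr hg₀ hg heq (mem_coordDom hx hq) hc).massDensity_eq,
    (e.agreeOnLevel hr hg₀ hg heq (mem_coordDom hx hp)
      (e.hasFDerivWithinAt_gram_sub_chart_change heq hx hp hq hc)).massDensity_eq,
    gram_chart_change g₀ hp hq, hw, jumpDensity_conj _ _ _ _ (isUnit_det_chartJacobian hp hq)]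

theorem Exhaustion.massIntegrand_eq (e : Exhaustion n X) (hr : e.start ≤ r)
    (hg₀ : IsMetricOn (e.dom r) g₀) (hg : IsMetricOn (e.dom r) g)
    (heq : ∀ x ∈ e.bdry r, g x = g₀ x) (hx : x ∈ e.bdry r) :
    e.massIntegrand r g₀ g x = 2 * (e.H r g₀ x - e.H r g x) := by
  have hy := mem_coordDom hx (mem_extChartAt_source (I := 𝓡∂ n) x)
  obtain ⟨c, hc⟩ := e.exists_hasFDerivWithinAt_gram_sub hr hg₀ hg heq hy
  have h := e.agreeOnLevel hr hg₀ hg heq hy hc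
  exact h.massDensity_eq.trans h.two_mul_meanCurv_sub.symm

/-- The chart used at `x` varies with `x` without any continuity. Chart independence replaces it
near `q` by the fixed chart at `q`, where the density is continuous. -/
theorem Exhaustion.continuousOn_massIntegrand (e : Exhaustion n X) (hr : e.start ≤ r)
    (hg₀ : IsMetricOn (e.dom r) g₀) (hg : IsMetricOn (e.dom r) g)
    (heq : ∀ x ∈ e.bdry r, g x = g₀ x) : ContinuousOn (e.massIntegrand r g₀ g) (e.bdry r) := by
  intro q hq
  have hqs : q ∈ (extChartAt (𝓡∂ n) q).source := mem_extChartAt_source q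
  have hcont : ContinuousOn (massDensity (coordDom (e.dom r) q) (gram g₀ q) (gram g q)
      (e.coordLevel q)) (coordDom (e.bdry r) q) :=
    continuousOn_massDensity (e.coordDom_bdry_subset r q) (e.uniqueDiffOn hr q) (hg₀.2 q)
      (fun z hz => isUnit_det_gram hg₀.1 hz) (hg.2 q)
      (continuousOn_pd (e.uniqueDiffOn hr q) (e.contDiffOn_coordLevel_dom r q))
      fun z hz => e.gradNormSq_pos hr hg₀.1 hz
  have h1 : ContinuousOn (fun x => massDensity (coordDom (e.dom r) q) (gram g₀ q) (gram g q)
      (e.coordLevel q) (extChartAt (𝓡∂ n) q x)) (e.bdry r ∩ (extChartAt (𝓡∂ n) q).source) :=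
    hcont.comp ((continuousOn_extChartAt q).mono inter_subset_right)
      fun x hx => mem_coordDom hx.1 hx.2
  have h2 : ContinuousOn (e.massIntegrand r g₀ g)
      (e.bdry r ∩ (extChartAt (𝓡∂ n) q).source) := h1.congr fun x hx =>
    e.massDensity_chart_change hr hg₀ hg heq hx.1 (mem_extChartAt_source x) hx.2
  exact (h2 q ⟨hq, hqs⟩).mono_of_mem_nhdsWithin
    (inter_mem self_mem_nhdsWithin
      (nhdsWithin_le_nhds ((isOpen_extChartAt_source q).mem_nhds hqs)))

end Level

/-! ### Finiteness of the surface measure and integration of the pointwise identity. -/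

section SurfaceMeasure

variable {n : ℕ} [NeZero n] {X : Type*} [TopologicalSpace X]
  [ChartedSpace (EuclideanHalfSpace n) X] [IsManifold (𝓡∂ n) ∞ X]
  {e : Exhaustion n X} {r : ℝ} {ρ : X → ℝ} {g₀ g : TwoTensor n X}

/-- Away from the boundary of `X` the function `ρ` is positive, so the factor `ρ⁻²` preserves both
positivity and `C¹` regularity. -/
theorem IsAH.isMetricOn {k : ℕ} {α : ℝ≥0} (hk : 1 ≤ k) (h : IsAH k α ρ g) {S : Set X}
    (hS : S ⊆ (𝓡∂ n).interior X) : IsMetricOn S g := by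
  obtain ⟨hρ, b, hb, hreg, hgb, -⟩ := h
  have hpos : ∀ x ∈ S, 0 < ρ x ^ 2 := fun x hx => by
    refine pow_pos ((hρ.nonneg x).lt_of_ne' fun h0 => ?_) 2
    exact (𝓡∂ n).disjoint_interior_boundary.notMem_of_mem_left (hS hx) ((hρ.zero_iff x).1 h0)
  refine ⟨fun x hx => ?_, fun p i j => ?_⟩
  · rw [hgb x (hS hx)]
    refine ⟨fun v w => congrArg ((ρ x ^ 2)⁻¹ * ·) ((hb x trivial).1 v w), fun v hv => ?_⟩
    exact mul_pos (inv_pos.2 (hpos x hx)) ((hb x trivial).2 v hv)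
  · have hsub : coordDom (n := n) S p ⊆ (extChartAt (𝓡∂ n) p).target := fun z hz => hz.1
    have hρs : ContDiffOn ℝ 1 (ρ ∘ (extChartAt (𝓡∂ n) p).symm) (coordDom S p) := by
      rw [← contMDiffOn_iff_contDiffOn]
      exact ((hρ.smooth.of_le (by simp)).comp_contMDiffOn
        ((contMDiffOn_extChartAt_symm (n := 1) p).mono hsub))
    have hbs : ContDiffOn ℝ 1 (fun y => gram b p y i j) (coordDom S p) :=
      ((hreg p i j).1.of_le (by exact_mod_cast hk)).mono hsub
    refine (((hρs.pow 2).inv fun z hz => (hpos _ hz.2).ne').mul hbs).congr fun z hz => ?_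
    simp only [gram, Matrix.of_apply, hgb _ (hS hz.2)]
    rfl

theorem Exhaustion.measurableSet_coordDom_bdry (e : Exhaustion n X) (r : ℝ) (p : X) :
    MeasurableSet (coordDom (n := n) (e.bdry r) p) := by
  have ho := isOpen_coordDom_interior (n := n) p
  have h := (e.contDiffOn_coordLevel p).continuousOn.isOpen_inter_preimage ho
    (isClosed_singleton (x := r)).isOpen_compl
  have : coordDom (e.bdry r) p = coordDom ((𝓡∂ n).interior X) p \
      (coordDom ((𝓡∂ n).interior X) p ∩ e.coordLevel p ⁻¹' {r}ᶜ) := by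
    rw [e.coordDom_bdry]
    ext z
    simp +contextual
  rw [this]
  exact ho.measurableSet.diff h.measurableSet

variable [T2Space X] [MeasurableSpace X]

theorem Exhaustion.chartSurfaceMeasure_lt_top [BorelSpace X] (e : Exhaustion n X) (hr : e.start ≤ r)
    (hg : IsMetricOn (e.dom r) g) {p : X} {B : Set X} (hB : IsCompact B) (hBr : B ⊆ e.bdry r)
    (hBp : B ⊆ (extChartAt (𝓡∂ n) p).source) : e.chartSurfaceMeasure r g p B < ⊤ := by
  rw [Exhaustion.chartSurfaceMeasure]
  set m := ((μHE[n - 1] : Measure (EuclideanSpace ℝ (Fin n))).restrict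
    (coordDom (e.bdry r) p)) with hm
  set σ := surfaceDensity (coordDom (e.dom r) p) (gram g p)
      (e.level ∘ (extChartAt (𝓡∂ n) p).symm) with hσ
  -- The pushforward along a map that is not a.e. measurable is the zero measure, for which the
  -- bound is trivial.
  by_cases hmeas : AEMeasurable (extChartAt (𝓡∂ n) p).symm
      (m.withDensity fun y => ENNReal.ofReal (σ y))
  swap
  · rw [Measure.map_of_not_aemeasurable hmeas]
    simp
  rw [Measure.map_apply_of_aemeasurable hmeas hB.measurableSet]
  set K := extChartAt (𝓡∂ n) p '' B with hK
  have hKc : IsCompact K := hB.image_of_continuousOn ((continuousOn_extChartAt p).mono hBp)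
  have hKsub : K ⊆ coordDom (e.bdry r) p := by
    rintro _ ⟨x, hx, rfl⟩
    exact mem_coordDom (hBr hx) (hBp hx)
  -- Off the chart target the inverse chart has arbitrary values, which may fall in `B`; such points
  -- lie where the restricted measure vanishes.
  have hpre : (extChartAt (𝓡∂ n) p).symm ⁻¹' B ⊆ K ∪ (coordDom (e.bdry r) p)ᶜ := by
    intro z hz
    by_cases hzb : z ∈ coordDom (e.bdry r) p
    · exact Or.inl ⟨_, hz, (extChartAt (𝓡∂ n) p).right_inv hzb.1⟩
    · exact Or.inr hzb
  refine (measure_mono hpre).trans_lt ((measure_union_le _ _).trans_lt ?_)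
  have h0 : (m.withDensity fun y => ENNReal.ofReal (σ y)) (coordDom (e.bdry r) p)ᶜ = 0 := by
    refine withDensity_absolutelyContinuous _ _ ?_
    rw [hm, Measure.restrict_apply (e.measurableSet_coordDom_bdry r p).compl]
    simp
  rw [h0, add_zero, withDensity_apply _ hKc.measurableSet]
  have hF := continuousOn_pd (e.uniqueDiffOn hr p) (e.contDiffOn_coordLevel_dom r p)
  have hcont : ContinuousOn σ K := by
    refine (continuousOn_surfaceDensity (e.coordDom_bdry_subset r p) (hg.2 p)
      (fun z hz => isUnit_det_gram hg.1 hz) hF fun z hz => ?_).mono hKsub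
    obtain ⟨i, hi⟩ := e.exists_pd_coordLevel_ne_zero hr hz
    exact (Finset.sum_pos' (fun j _ => sq_nonneg _)
      ⟨i, Finset.mem_univ i, by positivity⟩).ne'
  obtain ⟨M, hM⟩ := hKc.exists_bound_of_continuousOn hcont
  have hfin : (μHE[n - 1] : Measure (EuclideanSpace ℝ (Fin n))) K < ⊤ := by
    have := euclideanHausdorffMeasure_lt_top_of_level (F := e.coordLevel p) (r := r) hKc
      fun y hy => by
        have hyb := hKsub hy
        have hyi : y ∈ coordDom ((𝓡∂ n).interior X) p := ⟨hyb.1, hyb.2.1⟩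
        exact ⟨hyb.2.2, _, e.fderiv_coordLevel_ne_zero hyi (hr.trans_eq hyb.2.2.symm),
          e.hasStrictFDerivAt_coordLevel hyi⟩
    rwa [finrank_euclideanSpace_fin] at this
  calc ∫⁻ y in K, ENNReal.ofReal (σ y) ∂m ≤ ∫⁻ _ in K, ENNReal.ofReal M ∂m :=
        setLIntegral_mono' hKc.measurableSet fun y hy =>
          ENNReal.ofReal_le_ofReal ((le_abs_self _).trans (hM y hy))
    _ = ENNReal.ofReal M * m K := by rw [setLIntegral_const]
    _ < ⊤ := ENNReal.mul_lt_top ENNReal.ofReal_lt_top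
        ((Measure.restrict_apply_le _ _).trans_lt hfin)

variable [CompactSpace X]

theorem Exhaustion.dS_congr (e : Exhaustion n X) (heq : ∀ x ∈ e.bdry r, g x = g₀ x) :
    e.dS r g = e.dS r g₀ := by
  have h : ∀ p, e.chartSurfaceMeasure r g p = e.chartSurfaceMeasure r g₀ p := by
    intro p
    rw [Exhaustion.chartSurfaceMeasure, Exhaustion.chartSurfaceMeasure]
    congr 1
    refine withDensity_congr_ae ?_
    filter_upwards [ae_restrict_mem (e.measurableSet_coordDom_bdry r p)] with y hy
    rw [surfaceDensity_congr (gram_congr heq hy)]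
  simp only [Exhaustion.dS, h]

variable [BorelSpace X]

/-- By compactness only finitely many functions of the partition are nonzero. Each is at most one
and supported in its chart, so its contribution is bounded by the chart measure of a compact set. -/
theorem Exhaustion.dS_bdry_lt_top (e : Exhaustion n X) (hr : e.start ≤ r)
    (hg : IsMetricOn (e.dom r) g) : e.dS r g (e.bdry r) < ⊤ := by
  have hbc := e.isCompact_bdry hr
  have hbm := hbc.isClosed.measurableSet
  have hsub : (chartPartition n X).IsSubordinate fun p => (chartAt (EuclideanHalfSpace n) p).source :=
    (SmoothPartitionOfUnity.exists_isSubordinate_chartAt_source (𝓡∂ n) X).choose_spec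
  have hfin := (chartPartition n X).locallyFinite.finite_nonempty_of_compact
  rw [Exhaustion.dS, Measure.sum_apply _ hbm, tsum_eq_sum (s := hfin.toFinset)]
  · refine ENNReal.sum_lt_top.2 fun p _ => ?_
    rw [withDensity_apply _ hbm]
    set T := tsupport (chartPartition n X p) with hT
    have hTm : MeasurableSet T := (isClosed_tsupport _).measurableSet
    have hle : ∀ x, ENNReal.ofReal (chartPartition n X p x) ≤ T.indicator 1 x := by
      intro x
      by_cases hx : x ∈ T
      · rw [indicator_of_mem hx]
        exact ENNReal.ofReal_le_one.2 ((chartPartition n X).le_one p x)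
      · rw [image_eq_zero_of_notMem_tsupport hx]
        simp
    refine (lintegral_mono hle).trans_lt ?_
    rw [lintegral_indicator_one hTm, Measure.restrict_apply hTm, inter_comm]
    refine e.chartSurfaceMeasure_lt_top hr hg (hbc.inter_right (isClosed_tsupport _))
      inter_subset_left fun x hx => ?_
    rw [extChartAt_source]
    exact hsub p hx.2
  · intro p hp
    have h0 : ∀ x, chartPartition n X p x = 0 := by
      intro x
      by_contra hx
      exact hp (hfin.mem_toFinset.2 ⟨x, hx⟩)
    simp [h0]

/-- The mass integral relative to a metric with the same boundary values is twice the total jump of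
the mean curvature. -/
theorem Exhaustion.massADM_eq (e : Exhaustion n X) (hr : e.start ≤ r)
    (hg₀ : IsMetricOn (e.dom r) g₀) (hg : IsMetricOn (e.dom r) g)
    (heq : ∀ x ∈ e.bdry r, g x = g₀ x) :
    IntegrableOn (e.massIntegrand r g₀ g) (e.bdry r) (e.dS r g₀) ∧
    IntegrableOn (fun x => e.H r g₀ x - e.H r g x) (e.bdry r) (e.dS r g) ∧
    e.massADM r g₀ g = 2 * ∫ x in e.bdry r, (e.H r g₀ x - e.H r g x) ∂(e.dS r g) := by
  have hbc := e.isCompact_bdry hr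
  have hbm := hbc.isClosed.measurableSet
  have hcont := e.continuousOn_massIntegrand hr hg₀ hg heq
  have hmass : ∀ x ∈ e.bdry r, e.massIntegrand r g₀ g x = 2 * (e.H r g₀ x - e.H r g x) :=
    fun x hx => e.massIntegrand_eq hr hg₀ hg heq hx
  obtain ⟨M, hM⟩ := hbc.exists_bound_of_continuousOn hcont
  have hint : IntegrableOn (e.massIntegrand r g₀ g) (e.bdry r) (e.dS r g₀) :=
    IntegrableOn.of_bound (e.dS_bdry_lt_top hr hg₀)
      (hcont.aestronglyMeasurable hbm) M ((ae_restrict_iff' hbm).2 (Eventually.of_forall hM))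
  rw [e.dS_congr heq]
  refine ⟨hint, ?_, ?_⟩
  -- The jump of the mean curvature is half the mass integrand on `∂Σ_r`, so no separate regularity
  -- of either mean curvature is required.
  · refine (Integrable.const_mul hint (1 / 2)).congr ?_
    filter_upwards [ae_restrict_mem hbm] with x hx
    rw [hmass x hx]
    ring
  · rw [Exhaustion.massADM, setIntegral_congr_fun hbm hmass, integral_const_mul]

end SurfaceMeasure

end APE

end

theorem lemma4p3 {n : ℕ} [NeZero n] {X : Type*} [TopologicalSpace X]
    [ChartedSpace (EuclideanHalfSpace n) X] [IsManifold (𝓡∂ n) ∞ X] [T2Space X] [CompactSpace X]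
    [MeasurableSpace X] [BorelSpace X]
    (k : ℕ) (α : ℝ≥0) (δ : ℝ) (ρ : X → ℝ) (g₀ : APE.TwoTensor n X)
    (hg₀ : APE.IsAPE k α δ ρ g₀) (e : APE.Exhaustion n X) :
    (∀ r ≥ e.start, ∀ g : APE.TwoTensor n X,
      APE.IsMetricOn (e.dom r) g → (∀ x ∈ e.bdry r, g x = g₀ x) →
        IntegrableOn (e.massIntegrand r g₀ g) (e.bdry r) (e.dS r g₀) ∧
        IntegrableOn (fun x => e.H r g₀ x - e.H r g x) (e.bdry r) (e.dS r g) ∧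
        e.massADM r g₀ g = 2 * ∫ x in e.bdry r, (e.H r g₀ x - e.H r g x) ∂(e.dS r g)) ∧
    (∀ g : ℝ → APE.TwoTensor n X,
      (∀ᶠ r in atTop, APE.IsMetricOn (e.dom r) (g r) ∧ ∀ x ∈ e.bdry r, g r x = g₀ x) →
        Tendsto (fun r => 2 * (∫ x in e.bdry r, (e.H r g₀ x - e.H r (g r) x) ∂(e.dS r (g r)))
          - e.massADM r g₀ (g r)) atTop (𝓝 0)) := by
  have h₀ : ∀ r, APE.IsMetricOn (e.dom r) g₀ := fun r =>
    hg₀.isAH.isMetricOn (one_le_two.trans hg₀.two_le) fun x hx => hx.1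
  refine ⟨fun r hr g hg heq => e.massADM_eq hr (h₀ r) hg heq, fun g hg => ?_⟩
  -- By (i) the expression equals `0` as soon as `r ≥ e.start` and the conditions on `g r` hold.
  refine tendsto_const_nhds.congr' ?_
  filter_upwards [hg, eventually_ge_atTop e.start] with r hgr hr
  rw [(e.massADM_eq hr (h₀ r) hgr.1 hgr.2).2.2, sub_self]
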